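/- Notation. Let $n\ge 1$, $0<\mu<1$, $\Pi^{+}=\{\operatorname{Im}z>0\}$, $\Pi^{-}=\{\operatorname{Im}z<0\}$. Let $\mathcal H_\mu$ be the space of bounded functions on $\mathbb R$ (matrix functions: entrywise) that are Hölder continuous with exponent $\mu$ on the real line including the point at infinity, i.e. $|f(x)-f(y)|\le K\left(\frac{|x-y|}{\sqrt{1+x^2}\sqrt{1+y^2}}\right)^{\mu}$, with its natural norm $\|\cdot\|_\mu$. For integers $\varkappa_1\ge\dots\ge\varkappa_n$ put $$\Lambda(x)=\operatorname{diag}\Big(\Big(\tfrac{x-i}{x+i}\Big)^{\varkappa_j}\Big)_j,\qquad \Lambda^{\pm}(x)=\operatorname{diag}\Big(\Big(\tfrac{x-i}{x+i}\Big)^{\varkappa_j^{\pm}}\Big)_j,\qquad \varkappa_j^+=\max\{\varkappa_j,0\},\ \varkappa_j^-=\min\{\varkappa_j,0\},$$ so that $\Lambda=\Lambda^+\Lambda^-$. A bounded factorization of $G$ with partial indices $\varkappa_1,\dots,\varkappa_n$ is a representation $G=F^-\Lambda F^+$ on $\mathbb R$ in which $F^{\mp}$ and $(F^{\mp})^{-1}$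 are analytic in $\Pi^{\mp}$, continuous and bounded in $\overline{\Pi^{\mp}}$, with boundary values on $\mathbb R$ in $\mathcal H_\mu$. Let $G_0=G_0^-\Lambda G_0^+$ be a bounded factorization with unstable partial indices, $\varkappa_1-\varkappa_n\ge 2$, and let $G_\varepsilon=G_0+\varepsilon N_\varepsilon$ for $0\le\varepsilon<\varepsilon_0$, where $\sup_{0\le\varepsilon<\varepsilon_0}\|N_\varepsilon\|_\mu<\infty$. Put $M_{0,\varepsilon}=(m_{0,lj})=(G_0^-)^{-1}N_\varepsilon(G_0^+)^{-1}$ on $\mathbb R$ (the entries depend on $\varepsilon$) and $$(\Omega_0^{\mp}f)(z)=\mp\frac{z-i}{2\pi i}\int_{-\infty}^{\infty}\frac{f(\tau)\,d\tau}{(\tau-i)(\tau-z)},\qquad z\in\Pi^{\mp}.$$ Families $N^{\mp}_{1,\varepsilon}$, $0\le\varepsilon<\varepsilon_1$, are said to give a first-order bounded asymptotic factorization of $G_\varepsilon$ for $\varepsilon\in[0,\varepsilon_1)$ if, with all bounds uniform in $\varepsilon\in[0,\varepsilon_1)$: (a) $N_{1,\varepsilon}^{\mp}$ is analytic in $\Pi^{\mp}$,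 continuous and bounded in $\overline{\Pi^{\mp}}$, and bounded in $\|\cdot\|_\mu$ on $\mathbb R$; (b) the terms of first order agree: $N^-_{1,\varepsilon}\Lambda^-G_0^++G_0^-\Lambda^+N^+_{1,\varepsilon}=N_\varepsilon$ on $\mathbb R$; (c) $G^{*}_\varepsilon=\big(G_0^-+\varepsilon N_{1,\varepsilon}^-(\Lambda^+)^{-1}\big)\,\Lambda\,\big(G_0^++\varepsilon(\Lambda^-)^{-1}N_{1,\varepsilon}^+\big)$ is a bounded factorization with the same partial indices $\varkappa_1,\dots,\varkappa_n$, with the two brackets as its factors; (d) $\|G_\varepsilon-G^{*}_\varepsilon\|_\mu=O(\varepsilon^2)$. For a constant matrix $C=(c_{lj})$, which may depend on $\varepsilon$, the corresponding formal solution is $$N_{1,\varepsilon}^-=G_0^-\,[\Omega_0^-M_{0,\varepsilon}+C]\,(\Lambda^-)^{-1}\ \text{ in }\Pi^-\setminus\{-i\},\qquad N_{1,\varepsilon}^+=(\Lambda^+)^{-1}\,[\Omega_0^+M_{0,\varepsilon}-C]\,G_0^+\ \text{ in }\Pi^+\setminus\{i\};$$ it is understood to be extended by continuity to $\overline{\Pi^\mp}$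 where this is possible. Solvability conditions on $M_{0,\varepsilon}$: $$\int_{-\infty}^{\infty}\frac{m_{0,lk}(\tau)\,d\tau}{(\tau+i)^{r+1}}=0\quad\text{if }\varkappa_k<-1,\ 1\le r\le-\varkappa_k-1,\ 1\le l\le n;\tag{S1}$$ $$\int_{-\infty}^{\infty}\frac{m_{0,kj}(\tau)\,d\tau}{(\tau-i)^{r+1}}=0\quad\text{if }\varkappa_k>1,\ 1\le r\le\varkappa_k-1,\ 1\le j\le n;\tag{S2}$$ $$\int_{-\infty}^{\infty}\frac{m_{0,lj}(\tau)\,d\tau}{\tau^2+1}=0\quad\text{if }\varkappa_l>0>\varkappa_j.\tag{S3}$$ Prescribed constants: $$c_{lk}=-\frac1\pi\int_{-\infty}^{\infty}\frac{m_{0,lk}(\tau)\,d\tau}{\tau^2+1}\ \text{ if }\varkappa_k<0,\ 1\le l\le n;\qquad c_{kj}=0\ \text{ if }\varkappa_k>0,\ 1\le j\le n.\tag{C}$$ Theorem. (i) Let $C_\varepsilon$, $0\le\varepsilon<\varepsilon_0$, be constant matrices whose free entries $c_{lj}$ (those with $\varkappa_l\le0\le\varkappa_j$) are bounded in $\varepsilon$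 and otherwise arbitrary. There is $\varepsilon_1>0$ such that the formal solution with the constants $C_\varepsilon$ gives a first-order bounded asymptotic factorization of $G_\varepsilon$ for $\varepsilon\in[0,\varepsilon_1)$ if and only if there is $\varepsilon_1>0$ such that, for all $\varepsilon\in[0,\varepsilon_1)$, $M_{0,\varepsilon}$ satisfies (S1), (S2), (S3) and the entries of $C_\varepsilon$ are chosen as prescribed in (C). (ii) If $0<\varepsilon_1\le\varepsilon_0$ and arbitrary families $N^{\mp}_{1,\varepsilon}$ give a first-order bounded asymptotic factorization of $G_\varepsilon$ for $\varepsilon\in[0,\varepsilon_1)$, then for every $\varepsilon\in[0,\varepsilon_1)$ the conditions (S1), (S2), (S3) hold and $N^{\mp}_{1,\varepsilon}$ is the formal solution for some constant matrix satisfying (C). -/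

import Mathlib

namespace WienerHopf

/-- Chordal distance of two real points on the extended real line (up to the factor `2`, the
distance of the points `(x - i) / (x + i)` and `(y - i) / (y + i)` of the unit circle). -/
noncomputable def chord (x y : ℝ) : ℝ :=
  |x - y| / (Real.sqrt (1 + x ^ 2) * Real.sqrt (1 + y ^ 2))

/-- The scalar function `f` on the real line has Hölder norm at most `K`: `f` is bounded by `K`, and
it is Hölder continuous with exponent `μ` and constant `K` on the real line, including the point at
infinity. -/
def HolderBound (μ K : ℝ) (f : ℝ → ℂ) : Prop :=
  (∀ x, ‖f x‖ ≤ K) ∧ ∀ x y, ‖f x - f y‖ ≤ K * chord x y ^ μ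

/-- All entries of the matrix function `G` have Hölder norm at most `K`. -/
def MatHolderBound {n : ℕ} (μ K : ℝ) (G : ℝ → Matrix (Fin n) (Fin n) ℂ) : Prop :=
  ∀ i j, HolderBound μ K fun x => G x i j

/-- The open upper half-plane. -/
def upperHalf : Set ℂ := {z | 0 < z.im}

/-- The open lower half-plane. -/
def lowerHalf : Set ℂ := {z | z.im < 0}

/-- The diagonal matrix with entries `((z - i) / (z + i)) ^ κ j`. Its inverse is obtained by
changing `κ` into `-κ`. -/
noncomputable def lam {n : ℕ} (κ : Fin n → ℤ) (z : ℂ) : Matrix (Fin n) (Fin n) ℂ :=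
  Matrix.diagonal fun j => ((z - Complex.I) / (z + Complex.I)) ^ κ j

/-- The exponents `max (κ j) 0` of the factor `Λ⁺` of `Λ = Λ⁺ Λ⁻`. -/
def posIdx {n : ℕ} (κ : Fin n → ℤ) : Fin n → ℤ := fun j => max (κ j) 0

/-- The exponents `min (κ j) 0` of the factor `Λ⁻` of `Λ = Λ⁺ Λ⁻`. -/
def negIdx {n : ℕ} (κ : Fin n → ℤ) : Fin n → ℤ := fun j => min (κ j) 0

/-- `F` is a bounded factor in the half-plane `U`: together with its inverse it is analytic in `U`,
continuous and bounded by `K` in the closed half-plane, and its boundary values on the real line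
are, together with those of the inverse, of Hölder norm at most `K`. -/
structure IsBoundedFactor {n : ℕ} (μ K : ℝ) (U : Set ℂ)
    (F : ℂ → Matrix (Fin n) (Fin n) ℂ) : Prop where
  analytic : ∀ i j, DiffContOnCl ℂ (fun z => F z i j) U
  isUnit : ∀ z ∈ closure U, IsUnit (F z)
  analytic_inv : ∀ i j, DiffContOnCl ℂ (fun z => (F z)⁻¹ i j) U
  bounded : ∀ z ∈ closure U, ∀ i j, ‖F z i j‖ ≤ K
  bounded_inv : ∀ z ∈ closure U, ∀ i j, ‖(F z)⁻¹ i j‖ ≤ K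
  holder : MatHolderBound μ K fun x : ℝ => F (x : ℂ)
  holder_inv : MatHolderBound μ K fun x : ℝ => (F (x : ℂ))⁻¹

/-- `G = Fm Λ Fp` on the real line, a bounded right factorization with partial indices `κ`, all
bounds being by the constant `K`. -/
structure IsBoundedFactorization {n : ℕ} (μ K : ℝ) (κ : Fin n → ℤ)
    (Fm Fp : ℂ → Matrix (Fin n) (Fin n) ℂ) (G : ℝ → Matrix (Fin n) (Fin n) ℂ) : Prop where
  minus : IsBoundedFactor μ K lowerHalf Fm
  plus : IsBoundedFactor μ K upperHalf Fp
  eq : ∀ x : ℝ, G x = Fm x * lam κ x * Fp x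

/-- The factor `G₀⁻ + ε N⁻ (Λ⁺)⁻¹`. -/
noncomputable def minusFactor {n : ℕ} (κ : Fin n → ℤ) (Gm : ℂ → Matrix (Fin n) (Fin n) ℂ) (ε : ℝ)
    (Nm : ℂ → Matrix (Fin n) (Fin n) ℂ) (z : ℂ) : Matrix (Fin n) (Fin n) ℂ :=
  Gm z + (ε : ℂ) • (Nm z * lam (-posIdx κ) z)

/-- The factor `G₀⁺ + ε (Λ⁻)⁻¹ N⁺`. -/
noncomputable def plusFactor {n : ℕ} (κ : Fin n → ℤ) (Gp : ℂ → Matrix (Fin n) (Fin n) ℂ) (ε : ℝ)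
    (Np : ℂ → Matrix (Fin n) (Fin n) ℂ) (z : ℂ) : Matrix (Fin n) (Fin n) ℂ :=
  Gp z + (ε : ℂ) • (lam (-negIdx κ) z * Np z)

/-- The approximation `(G₀⁻ + ε N⁻ (Λ⁺)⁻¹) Λ (G₀⁺ + ε (Λ⁻)⁻¹ N⁺)` on the real line. -/
noncomputable def approx {n : ℕ} (κ : Fin n → ℤ) (Gm Gp : ℂ → Matrix (Fin n) (Fin n) ℂ) (ε : ℝ)
    (Nm Np : ℂ → Matrix (Fin n) (Fin n) ℂ) (x : ℝ) : Matrix (Fin n) (Fin n) ℂ :=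
  minusFactor κ Gm ε Nm x * lam κ x * plusFactor κ Gp ε Np x

/-- The families `Nm ε`, `Np ε` give a first order bounded asymptotic factorization of the family
`G ε = G₀ + ε N ε`, with the partial indices `κ` of `G₀ = Gm Λ Gp`, for all `ε` in `[0, ε₁)`.
The bounds in all fields are uniform in `ε`. -/
structure IsFirstOrderFactorization {n : ℕ} (μ : ℝ) (κ : Fin n → ℤ)
    (Gm Gp : ℂ → Matrix (Fin n) (Fin n) ℂ) (G N : ℝ → ℝ → Matrix (Fin n) (Fin n) ℂ)
    (Nm Np : ℝ → ℂ → Matrix (Fin n) (Fin n) ℂ) (ε₁ : ℝ) : Prop where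
  /-- The correction terms are analytic in their half-planes and continuous up to the real line. -/
  analytic_minus : ∀ ε ∈ Set.Ico 0 ε₁, ∀ i j, DiffContOnCl ℂ (fun z => Nm ε z i j) lowerHalf
  analytic_plus : ∀ ε ∈ Set.Ico 0 ε₁, ∀ i j, DiffContOnCl ℂ (fun z => Np ε z i j) upperHalf
  /-- They are bounded in the closed half-planes, and in the Hölder norm on the real line. -/
  bounded_minus : ∃ K, ∀ ε ∈ Set.Ico 0 ε₁,
    (∀ z ∈ closure lowerHalf, ∀ i j, ‖Nm ε z i j‖ ≤ K) ∧
      MatHolderBound μ K fun x : ℝ => Nm ε (x : ℂ)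
  bounded_plus : ∃ K, ∀ ε ∈ Set.Ico 0 ε₁,
    (∀ z ∈ closure upperHalf, ∀ i j, ‖Np ε z i j‖ ≤ K) ∧
      MatHolderBound μ K fun x : ℝ => Np ε (x : ℂ)
  /-- The terms of first order in `ε` agree: `N⁻ Λ⁻ G₀⁺ + G₀⁻ Λ⁺ N⁺ = N` on the real line. -/
  first_order : ∀ ε ∈ Set.Ico 0 ε₁, ∀ x : ℝ,
    Nm ε x * lam (negIdx κ) x * Gp x + Gm x * lam (posIdx κ) x * Np ε x = N ε x
  /-- The approximation has a bounded factorization with the partial indices `κ`. -/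
  factorization : ∃ K, ∀ ε ∈ Set.Ico 0 ε₁,
    IsBoundedFactorization μ K κ (minusFactor κ Gm ε (Nm ε)) (plusFactor κ Gp ε (Np ε))
      (approx κ Gm Gp ε (Nm ε) (Np ε))
  /-- The approximation differs from `G ε` by `O(ε²)` in the Hölder norm. -/
  remainder : ∃ K, ∀ ε ∈ Set.Ico 0 ε₁,
    MatHolderBound μ (K * ε ^ 2) fun x => G ε x - approx κ Gm Gp ε (Nm ε) (Np ε) x

/-- The Cauchy type integral `Ω⁻ f`, for `z` in the lower half-plane. -/
noncomputable def omegaMinus (f : ℝ → ℂ) (z : ℂ) : ℂ :=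
  -((z - Complex.I) / (2 * Real.pi * Complex.I)) * ∫ τ : ℝ, f τ / ((τ - Complex.I) * (τ - z))

/-- The Cauchy type integral `Ω⁺ f`, for `z` in the upper half-plane. -/
noncomputable def omegaPlus (f : ℝ → ℂ) (z : ℂ) : ℂ :=
  ((z - Complex.I) / (2 * Real.pi * Complex.I)) * ∫ τ : ℝ, f τ / ((τ - Complex.I) * (τ - z))

/-- The matrix function `M₀ = (G₀⁻)⁻¹ N (G₀⁺)⁻¹` on the real line. -/
noncomputable def midMatrix {n : ℕ} (Gm Gp : ℂ → Matrix (Fin n) (Fin n) ℂ)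
    (N : ℝ → Matrix (Fin n) (Fin n) ℂ) (x : ℝ) : Matrix (Fin n) (Fin n) ℂ :=
  (Gm x)⁻¹ * N x * (Gp x)⁻¹

/-- `Nm` and `Np` are given in the open half-planes by
`N⁻ = G₀⁻ (Ω⁻ M + C) (Λ⁻)⁻¹` and `N⁺ = (Λ⁺)⁻¹ (Ω⁺ M - C) G₀⁺`,
away from the points `-i` and `i`, where these formulas may be singular. -/
def IsFormalSolution {n : ℕ} (κ : Fin n → ℤ) (Gm Gp : ℂ → Matrix (Fin n) (Fin n) ℂ)
    (M : ℝ → Matrix (Fin n) (Fin n) ℂ) (C : Matrix (Fin n) (Fin n) ℂ)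
    (Nm Np : ℂ → Matrix (Fin n) (Fin n) ℂ) : Prop :=
  (∀ z ∈ lowerHalf, z ≠ -Complex.I →
    Nm z = Gm z * (Matrix.of (fun l j => omegaMinus (fun τ => M τ l j) z) + C) *
      lam (-negIdx κ) z) ∧
  (∀ z ∈ upperHalf, z ≠ Complex.I →
    Np z = lam (-posIdx κ) z * (Matrix.of (fun l j => omegaPlus (fun τ => M τ l j) z) - C) *
      Gp z)

/-- The solvability (moment) conditions on the entries of `M`. -/
structure SolvabilityConditions {n : ℕ} (κ : Fin n → ℤ)
    (M : ℝ → Matrix (Fin n) (Fin n) ℂ) : Prop where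
  neg : ∀ k, κ k < -1 → ∀ r : ℕ, 1 ≤ r → (r : ℤ) ≤ -κ k - 1 → ∀ l,
    ∫ τ : ℝ, M τ l k / ((τ : ℂ) + Complex.I) ^ (r + 1) = 0
  pos : ∀ k, 1 < κ k → ∀ r : ℕ, 1 ≤ r → (r : ℤ) ≤ κ k - 1 → ∀ j,
    ∫ τ : ℝ, M τ k j / ((τ : ℂ) - Complex.I) ^ (r + 1) = 0
  mixed : ∀ l j, 0 < κ l → κ j < 0 → ∫ τ : ℝ, M τ l j / ((τ : ℂ) ^ 2 + 1) = 0

/-- The prescribed choice of the constants; the entries `C l j` with `κ l ≤ 0 ≤ κ j` are free. -/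
structure PrescribedConstants {n : ℕ} (κ : Fin n → ℤ) (M : ℝ → Matrix (Fin n) (Fin n) ℂ)
    (C : Matrix (Fin n) (Fin n) ℂ) : Prop where
  neg : ∀ k, κ k < 0 → ∀ l, C l k = -(1 / Real.pi) * ∫ τ : ℝ, M τ l k / ((τ : ℂ) ^ 2 + 1)
  pos : ∀ k, 0 < κ k → ∀ j, C k j = 0

end WienerHopf

namespace WienerHopf

open Complex MeasureTheory Filter Topology Set Metric

/-! Write w = (x - i)/(x + i), A = (G₀⁻)⁻¹N⁻ and B = N⁺(G₀⁺)⁻¹. The first-order equation (b) becomes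
M = AΛ⁻ + Λ⁺B, and this decouples: the (l, j) entry reads m = wᵖb + w⁻ᑫa with p = max(κ_l, 0) and q
= max(-κ_j, 0). Everything thus rests on a scalar additive jump problem m = P + Q, with P bounded
analytic above and vanishing to order p at i, and Q bounded analytic below and vanishing to order q
at -i.

For any such splitting, Cauchy's formula gives Ω⁺m = P - P(i) and Ω⁻m = Q + P(i) (`omegaPlus_eq`,
`omegaMinus_eq`), so the constant of the formal solution is c = -P(i). If p > 0 this is 0. Since ∫
m/(τ² + 1) = π(P(i) + Q(-i)), the value for q > 0 is the other prescribed one; (S3) says that the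
two agree. The moments in (S1) and (S2) detect the higher zeros: once P = wʳb, the r-th moment is a
nonzero multiple of b(i) (`integral_moment_upper`). This gives necessity in `solvability_of_factor`
and, by dividing out one zero at a time, the factorizations of `exists_factor_upper` and
`exists_factor_lower`.

Sufficiency also needs a splitting m = P + Q to exist, with Hölder bounds linear in the bound of m
(`exists_jump`). The Cayley transform moves the question to the unit circle, where it is Privalov's
theorem: the derivative of the Cauchy integral grows at most like (1 - |w|)^(μ-1), the
Hardy–Littlewood argument turns this into Hölder continuity up to the circle, and a Poisson kernel
estimate gives the jump relation.

From A and B the factorization follows. The brackets are G₀⁻(1 + εA(Λ⁺)⁻¹) and (1 + ε(Λ⁻)⁻¹B)G₀⁺,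
uniformly invertible for small ε (`UnifMat.one_add_smul`), and the error G - G* is exactly -ε²N⁻N⁺
(`sub_approx_eq`). -/

theorem closure_upperHalf : closure upperHalf = {z : ℂ | 0 ≤ z.im} :=
  Complex.closure_setOfPred_lt_im 0

theorem closure_lowerHalf : closure lowerHalf = {z : ℂ | z.im ≤ 0} :=
  Complex.closure_setOfPred_im_lt 0

theorem isOpen_upperHalf : IsOpen upperHalf := isOpen_lt continuous_const continuous_im

theorem ofReal_mem_closure_upperHalf (x : ℝ) : (x : ℂ) ∈ closure upperHalf := by
  simp [closure_upperHalf]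

theorem ofReal_mem_closure_lowerHalf (x : ℝ) : (x : ℂ) ∈ closure lowerHalf := by
  simp [closure_lowerHalf]

/-! ### Bounded analytic functions in a half-plane -/

/-- `f` is analytic in `U`, continuous and bounded by `K` in the closure of `U`. -/
structure BddAnalytic (K : ℝ) (U : Set ℂ) (f : ℂ → ℂ) : Prop where
  diff : DiffContOnCl ℂ f U
  bound : ∀ z ∈ closure U, ‖f z‖ ≤ K

namespace BddAnalytic

variable {K L : ℝ} {U : Set ℂ} {f g : ℂ → ℂ}

theorem add (hf : BddAnalytic K U f) (hg : BddAnalytic L U g) :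
    BddAnalytic (K + L) U fun z => f z + g z :=
  ⟨hf.diff.add hg.diff, fun z hz => (norm_add_le _ _).trans
    (add_le_add (hf.bound z hz) (hg.bound z hz))⟩

theorem mul (hf : BddAnalytic K U f) (hg : BddAnalytic L U g) :
    BddAnalytic (K * L) U fun z => f z * g z :=
  ⟨hf.diff.smul hg.diff, fun z hz => by
    rw [norm_mul]
    exact mul_le_mul (hf.bound z hz) (hg.bound z hz) (norm_nonneg _)
      ((norm_nonneg _).trans (hf.bound z hz))⟩

theorem const (c : ℂ) : BddAnalytic ‖c‖ U fun _ => c :=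
  ⟨diffContOnCl_const, fun _ _ => le_rfl⟩

theorem neg (hf : BddAnalytic K U f) : BddAnalytic K U fun z => -f z :=
  ⟨hf.diff.neg, fun z hz => by rw [norm_neg]; exact hf.bound z hz⟩

theorem sub (hf : BddAnalytic K U f) (hg : BddAnalytic L U g) :
    BddAnalytic (K + L) U fun z => f z - g z := by
  simpa only [sub_eq_add_neg] using hf.add hg.neg

theorem mono (hf : BddAnalytic K U f) (h : K ≤ L) : BddAnalytic L U f :=
  ⟨hf.diff, fun z hz => (hf.bound z hz).trans h⟩

theorem pow (hf : BddAnalytic K U f) (s : ℕ) : BddAnalytic (K ^ s) U fun z => f z ^ s := by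
  induction s with
  | zero => simpa using const (U := U) 1
  | succ s ih => simpa only [pow_succ] using ih.mul hf

theorem continuous_upper (hf : BddAnalytic K upperHalf f) : Continuous fun x : ℝ => f x :=
  hf.diff.continuousOn.comp_continuous continuous_ofReal ofReal_mem_closure_upperHalf

theorem continuous_lower (hf : BddAnalytic K lowerHalf f) : Continuous fun x : ℝ => f x :=
  hf.diff.continuousOn.comp_continuous continuous_ofReal ofReal_mem_closure_lowerHalf

end BddAnalytic

/-- The reflection z ↦ -z preserves `chord` and inverts `cayley`, so facts about the lower
half-plane can be deduced from those about the upper one. -/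
theorem mapsTo_neg_upper : MapsTo (fun z : ℂ => -z) upperHalf lowerHalf := fun z hz => by
  simpa [upperHalf, lowerHalf] using hz

theorem mapsTo_neg_lower : MapsTo (fun z : ℂ => -z) lowerHalf upperHalf := fun z hz => by
  simpa [upperHalf, lowerHalf] using hz

theorem BddAnalytic.reflect_lower {K : ℝ} {f : ℂ → ℂ} (hf : BddAnalytic K lowerHalf f) :
    BddAnalytic K upperHalf fun z => f (-z) :=
  ⟨hf.diff.comp (differentiable_neg.diffContOnCl) mapsTo_neg_upper, fun z hz =>
    hf.bound _ (by rw [closure_upperHalf] at hz; rw [closure_lowerHalf]; simpa using hz)⟩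

theorem BddAnalytic.reflect_upper {K : ℝ} {f : ℂ → ℂ} (hf : BddAnalytic K upperHalf f) :
    BddAnalytic K lowerHalf fun z => f (-z) :=
  ⟨hf.diff.comp (differentiable_neg.diffContOnCl) mapsTo_neg_lower, fun z hz =>
    hf.bound _ (by rw [closure_lowerHalf] at hz; rw [closure_upperHalf]; simpa using hz)⟩

/-! ### Cauchy's theorem and Cauchy's formula in a half-plane -/

theorem integrable_of_decay {f : ℝ → ℂ} (hf : Continuous f) {C : ℝ}
    (h : ∀ x, ‖f x‖ ≤ C / (1 + |x|) ^ 2) : Integrable f := by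
  have hC : 0 ≤ C := by simpa using (norm_nonneg _).trans (h 0)
  refine (integrable_inv_one_add_sq.const_mul C).mono' hf.aestronglyMeasurable
    (Eventually.of_forall fun x => (h x).trans ?_)
  rw [← div_eq_mul_inv]
  have := abs_nonneg x
  gcongr
  nlinarith [sq_abs x]

/-- Cauchy's theorem for the upper half-plane. -/
theorem integral_eq_zero_of_decay {f : ℂ → ℂ} (hf : DiffContOnCl ℂ f upperHalf) {C : ℝ}
    (h : ∀ z ∈ closure upperHalf, ‖f z‖ ≤ C / (1 + ‖z‖) ^ 2) : ∫ x : ℝ, f x = 0 := by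
  have hC : 0 ≤ C := by
    simpa using (norm_nonneg _).trans (h 0 (by simp [closure_upperHalf]))
  have hcont : Continuous fun x : ℝ => f x :=
    hf.continuousOn.comp_continuous continuous_ofReal ofReal_mem_closure_upperHalf
  have hint : Integrable fun x : ℝ => f x := integrable_of_decay hcont (C := C) fun x => by
    simpa using h x (ofReal_mem_closure_upperHalf x)
  have hlim := intervalIntegral_tendsto_integral hint tendsto_neg_atTop_atBot tendsto_id
  refine tendsto_nhds_unique hlim ?_
  -- Cauchy's theorem on the rectangle with opposite corners -R and R + iR. The three sides off the
  -- real line have total length 4R, and there |z| ≥ R, so |f| ≤ C / R².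
  have hb : ∀ R : ℝ, 0 < R → ‖∫ x in (-R)..R, f x‖ ≤ 4 * C / R := by
    intro R hR
    have key := Complex.integral_boundary_rect_eq_zero_of_continuousOn_of_differentiableOn f
      (-R : ℝ) (R + R * I) (hf.continuousOn.mono ?_) (hf.differentiableOn.mono ?_)
    · have hbig : ∀ z : ℂ, 0 ≤ z.im → R ≤ ‖z‖ → ‖f z‖ ≤ C / R ^ 2 := fun z hz hzR => by
        refine (h z (by simpa [closure_upperHalf] using hz)).trans ?_
        gcongr
        linarith
      have e1 : ‖∫ x in (-R)..R, f (x + R * I)‖ ≤ C / R ^ 2 * |R - -R| :=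
        intervalIntegral.norm_integral_le_of_norm_le_const fun x _ => hbig _ (by simpa using hR.le)
          (by simpa [abs_of_pos hR] using abs_im_le_norm (x + R * I))
      have e2 : ‖∫ y in (0 : ℝ)..R, f (R + y * I)‖ ≤ C / R ^ 2 * |R - 0| :=
        intervalIntegral.norm_integral_le_of_norm_le_const fun y hy => hbig _
          (by rw [uIoc_of_le hR.le] at hy; simpa using hy.1.le)
          (by simpa [abs_of_pos hR] using abs_re_le_norm (R + y * I))
      have e3 : ‖∫ y in (0 : ℝ)..R, f ((-R : ℝ) + y * I)‖ ≤ C / R ^ 2 * |R - 0| :=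
        intervalIntegral.norm_integral_le_of_norm_le_const fun y hy => hbig _
          (by rw [uIoc_of_le hR.le] at hy; simpa using hy.1.le)
          (by simpa [abs_of_pos hR] using abs_re_le_norm ((-R : ℝ) + y * I))
      simp only [ofReal_re, ofReal_im, add_re, mul_re, I_re, I_im, mul_zero, mul_one, sub_self,
        add_zero, add_im, mul_im, zero_add, ofReal_zero, zero_mul] at key
      have e : ∫ x in (-R)..R, f x = (∫ x in (-R)..R, f (x + R * I)) -
          I • (∫ y in (0 : ℝ)..R, f (R + y * I)) + I • ∫ y in (0 : ℝ)..R, f ((-R : ℝ) + y * I) := by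
        linear_combination (exp := 1) key
      rw [e]
      refine (norm_add_le _ _).trans ((add_le_add_left (norm_sub_le _ _) _).trans ?_)
      rw [norm_smul, norm_smul, norm_I, one_mul, one_mul]
      have a1 : |R - -R| = 2 * R := by rw [sub_neg_eq_add, ← two_mul]; exact abs_of_pos (by positivity)
      have a2 : |R - 0| = R := by rw [sub_zero, abs_of_pos hR]
      rw [a1] at e1
      rw [a2] at e2 e3
      have : 4 * C / R = C / R ^ 2 * (2 * R) + C / R ^ 2 * R + C / R ^ 2 * R := by
        field_simp; ring
      linarith
    · rintro z hz
      have := hz.2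
      simp [uIcc_of_le hR.le] at this
      simpa [closure_upperHalf] using this.1
    · rintro z hz
      have := hz.2
      simp [hR.le] at this
      exact this.1
  refine squeeze_zero_norm' (a := fun R => 4 * C / R) ?_ (tendsto_const_nhds.div_atTop tendsto_id)
  filter_upwards [eventually_gt_atTop 0] with R hR
  exact hb R hR

theorem sub_ne_zero_of_im_neg {a z : ℂ} (ha : a.im < 0) (hz : z ∈ closure upperHalf) :
    z - a ≠ 0 := fun h => by
  rw [closure_upperHalf] at hz
  have : z.im = a.im := by rw [sub_eq_zero.1 h]
  simp only [mem_ofPred_eq] at hz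
  linarith

theorem exists_norm_inv_sub_le {a : ℂ} (ha : a.im < 0) :
    ∃ D, 0 ≤ D ∧ ∀ z ∈ closure upperHalf, ‖(z - a)⁻¹‖ ≤ D / (1 + ‖z‖) := by
  -- The constant comes from |z| ≤ |z - a| + |a| together with |z - a| ≥ -Im a, which bounds 1 + |a|
  -- by a multiple of |z - a|.
  refine ⟨1 + (1 + ‖a‖) / -a.im, by have := neg_pos.2 ha; positivity, fun z hz => ?_⟩
  have h0 := norm_pos_iff.2 (sub_ne_zero_of_im_neg ha hz)
  rw [norm_inv, inv_le_iff_one_le_mul₀' h0, ← mul_div_assoc, one_le_div (by positivity), mul_add,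
    mul_one]
  have h1 : -a.im ≤ ‖z - a‖ := by
    have := (le_abs_self _).trans (abs_im_le_norm (z - a))
    rw [closure_upperHalf, mem_ofPred_eq] at hz
    rw [sub_im] at this
    linarith
  have h2 : 1 + ‖a‖ ≤ ‖z - a‖ * ((1 + ‖a‖) / -a.im) := by
    rw [← mul_div_assoc, le_div_iff₀ (neg_pos.2 ha), mul_comm]
    gcongr
  have h3 : ‖z‖ ≤ ‖z - a‖ + ‖a‖ := by simpa using norm_add_le (z - a) a
  linarith

theorem diffContOnCl_inv_sub {a : ℂ} (ha : a.im < 0) :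
    DiffContOnCl ℂ (fun z => (z - a)⁻¹) upperHalf :=
  (differentiable_id.sub_const a).diffContOnCl.inv fun _ hz => sub_ne_zero_of_im_neg ha hz

theorem bddAnalytic_inv_sub {a : ℂ} (ha : a.im < 0) :
    ∃ D, BddAnalytic D upperHalf fun z => (z - a)⁻¹ := by
  obtain ⟨D, hD0, hD⟩ := exists_norm_inv_sub_le ha
  refine ⟨D, diffContOnCl_inv_sub ha, fun z hz => (hD z hz).trans (div_le_self hD0 ?_)⟩
  linarith [norm_nonneg z]

/-- Both poles lie below the line, so nothing is enclosed above it, and the two factors supply the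
quadratic decay that a merely bounded f lacks. -/
theorem integral_div_eq_zero_upper {K : ℝ} {f : ℂ → ℂ} (hf : BddAnalytic K upperHalf f) {a b : ℂ}
    (ha : a.im < 0) (hb : b.im < 0) : ∫ x : ℝ, f x / ((x - a) * (x - b)) = 0 := by
  obtain ⟨D, hD0, hD⟩ := exists_norm_inv_sub_le ha
  obtain ⟨E, hE0, hE⟩ := exists_norm_inv_sub_le hb
  have := integral_eq_zero_of_decay (f := fun z => f z * ((z - a)⁻¹ * (z - b)⁻¹)) (C := K * (D * E))
    (hf.diff.smul ((diffContOnCl_inv_sub ha).smul (diffContOnCl_inv_sub hb))) fun z hz => ?_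
  · simpa only [div_eq_mul_inv, mul_inv] using this
  · rw [norm_mul, norm_mul, mul_div_assoc, sq, ← div_mul_div_comm]
    have := hf.bound z hz
    have := hD z hz
    have := hE z hz
    have := (norm_nonneg _).trans (hf.bound z hz)
    gcongr

theorem integral_div_eq_zero_lower {K : ℝ} {f : ℂ → ℂ} (hf : BddAnalytic K lowerHalf f) {a b : ℂ}
    (ha : 0 < a.im) (hb : 0 < b.im) : ∫ x : ℝ, f x / ((x - a) * (x - b)) = 0 := by
  rw [← integral_neg_eq_self]
  have := integral_div_eq_zero_upper hf.reflect_lower (a := -a) (b := -b) (by simpa) (by simpa)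
  rw [← this]
  congr 1 with x
  push_cast
  congr 1
  ring

theorem sub_ne_zero_of_im_ne {a : ℂ} (ha : a.im ≠ 0) (x : ℝ) : (x : ℂ) - a ≠ 0 := fun h => ha <| by
  rw [← sub_eq_zero.1 h, ofReal_im]

theorem integrable_div {f : ℝ → ℂ} (hf : Continuous f) {K : ℝ} (hK : ∀ x, ‖f x‖ ≤ K) {a b : ℂ}
    (ha : a.im ≠ 0) (hb : b.im ≠ 0) : Integrable fun x : ℝ => f x / ((x - a) * (x - b)) := by
  have key : ∀ {a : ℂ}, a.im ≠ 0 → ∃ D, 0 ≤ D ∧ ∀ x : ℝ, ‖((x : ℂ) - a)⁻¹‖ ≤ D / (1 + |x|) := by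
    intro a ha
    rcases ha.lt_or_gt with h | h
    · obtain ⟨D, h0, hD⟩ := exists_norm_inv_sub_le h
      exact ⟨D, h0, fun x => by simpa using hD x (ofReal_mem_closure_upperHalf x)⟩
    · obtain ⟨D, h0, hD⟩ := exists_norm_inv_sub_le (a := -a) (by simpa using h)
      refine ⟨D, h0, fun x => ?_⟩
      have := hD (-x : ℝ) (ofReal_mem_closure_upperHalf _)
      rw [norm_inv] at this ⊢
      rw [← norm_neg]
      have e1 : ((-x : ℝ) : ℂ) - -a = -((x : ℂ) - a) := by push_cast; ring
      have e2 : ‖((-x : ℝ) : ℂ)‖ = |x| := by simp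
      rwa [e1, e2] at this
  obtain ⟨D, hD0, hD⟩ := key ha
  obtain ⟨E, hE0, hE⟩ := key hb
  refine integrable_of_decay (C := K * (D * E)) ?_ fun x => ?_
  · exact hf.div (by fun_prop) fun x => mul_ne_zero (sub_ne_zero_of_im_ne ha x) (sub_ne_zero_of_im_ne hb x)
  · rw [div_eq_mul_inv, mul_inv, norm_mul, norm_mul, mul_div_assoc, sq, ← div_mul_div_comm]
    have := hK x
    have := hD x
    have := hE x
    have := (norm_nonneg _).trans (hK x)
    gcongr

/-- The case z = i, a = -i is the integral of 1/(1 + x²). Partial fractions reduce the general case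
to it, up to terms with both poles on the same side of the line, whose integrals vanish. -/
theorem integral_one_div {z a : ℂ} (hz : 0 < z.im) (ha : a.im < 0) :
    ∫ x : ℝ, 1 / (((x : ℂ) - a) * (x - z)) = 2 * Real.pi * I / (z - a) := by
  have hza : z - a ≠ 0 := fun h => by
    have : z.im = a.im := by rw [sub_eq_zero.1 h]
    linarith
  have i0 : ∫ x : ℝ, 1 / (((x : ℂ) - -I) * (x - I)) = Real.pi := by
    rw [← integral_univ_inv_one_add_sq, ← integral_complex_ofReal]
    congr 1 with x
    push_cast
    rw [one_div]
    congr 1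
    linear_combination -I_sq
  have int : ∀ {a b : ℂ}, a.im ≠ 0 → b.im ≠ 0 →
      Integrable fun x : ℝ => 1 / (((x : ℂ) - a) * (x - b)) := fun ha hb =>
    integrable_div (f := fun _ => 1) continuous_const (K := 1) (by simp) ha hb
  have iu : ∫ x : ℝ, 1 / (((x : ℂ) - a) * (x - -I)) = 0 :=
    integral_div_eq_zero_upper (f := fun _ => 1) (BddAnalytic.const 1) ha (by simp)
  have il : ∫ x : ℝ, 1 / (((x : ℂ) - z) * (x - I)) = 0 :=
    integral_div_eq_zero_lower (f := fun _ => 1) (BddAnalytic.const 1) hz (by simp)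
  have hI : (I : ℂ).im ≠ 0 := by simp
  have hI' : (-I : ℂ).im ≠ 0 := by simp
  have e : ∀ x : ℝ, (z - a) * (1 / (((x : ℂ) - a) * (x - z))) =
      2 * I * (1 / (((x : ℂ) - -I) * (x - I))) + ((z - I) * (1 / (((x : ℂ) - z) * (x - I))) -
        (a + I) * (1 / (((x : ℂ) - a) * (x - -I)))) := fun x => by
    have h1 := sub_ne_zero_of_im_ne ha.ne x
    have h2 := sub_ne_zero_of_im_ne hz.ne' x
    have h3 := sub_ne_zero_of_im_ne hI x
    have h4 := sub_ne_zero_of_im_ne hI' x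
    field_simp
    ring
  rw [eq_div_iff hza, mul_comm, ← integral_const_mul]
  simp_rw [e]
  have hs := ((int hz.ne' hI).const_mul (z - I)).sub ((int ha.ne hI').const_mul (a + I))
  simp only [Pi.sub_def] at hs
  rw [integral_add ((int hI' hI).const_mul _) hs, integral_sub ((int hz.ne' hI).const_mul _)
    ((int ha.ne hI').const_mul _), integral_const_mul, integral_const_mul, integral_const_mul,
    i0, iu, il]
  ring

/-- Division of a bounded analytic function by a Blaschke-type factor at one of its zeros. -/
theorem exists_div_upper {z₀ a : ℂ} (hz : 0 < z₀.im) (ha : a.im < 0) :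
    ∃ D, 0 ≤ D ∧ ∀ (K : ℝ) (f : ℂ → ℂ), BddAnalytic K upperHalf f → f z₀ = 0 →
      ∃ b, BddAnalytic (D * K) upperHalf b ∧
        ∀ z ∈ closure upperHalf, f z = (z - z₀) / (z - a) * b z := by
  -- Half the distance to the real line, so that the closed disc stays inside the half-plane.
  -- Outside it (z - a)/(z - z₀) is bounded directly; inside it the maximum principle applies. The
  -- resulting constant does not depend on f.
  set r := z₀.im / 2 with hr
  have hr0 : 0 < r := by positivity
  have hball : Metric.closedBall z₀ r ⊆ upperHalf := fun z hzb => by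
    have := (abs_im_le_norm (z - z₀)).trans (mem_closedBall_iff_norm.1 hzb)
    rw [sub_im, abs_le] at this
    simp only [upperHalf, mem_ofPred_eq]
    linarith [this.1]
  refine ⟨1 + ‖z₀ - a‖ / r, by positivity, fun K f hf h0 => ?_⟩
  have hfac : ∀ z ∈ closure upperHalf, f z = (z - z₀) / (z - a) * (dslope f z₀ z * (z - a)) := by
    intro z hz
    have h1 := sub_ne_zero_of_im_neg ha hz
    have h2 := sub_smul_dslope f z₀ z
    rw [h0, sub_zero, smul_eq_mul] at h2
    rw [← h2]
    field_simp
  have hn : upperHalf ∈ 𝓝 z₀ := isOpen_upperHalf.mem_nhds hz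
  have hd : DiffContOnCl ℂ (fun z => dslope f z₀ z * (z - a)) upperHalf := by
    refine DiffContOnCl.smul (𝕜' := ℂ) ⟨?_, ?_⟩ (differentiable_id.sub_const a).diffContOnCl
    · exact (Complex.differentiableOn_dslope hn).2 hf.diff.differentiableOn
    · exact (continuousOn_dslope (mem_of_superset hn subset_closure)).2
        ⟨hf.diff.continuousOn, hf.diff.differentiableAt isOpen_upperHalf hz⟩
  have hfar : ∀ z ∈ closure upperHalf, r ≤ ‖z - z₀‖ →
      ‖dslope f z₀ z * (z - a)‖ ≤ (1 + ‖z₀ - a‖ / r) * K := by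
    intro z hz hzr
    have h1 := sub_ne_zero_of_im_neg ha hz
    have h2 : z - z₀ ≠ 0 := norm_pos_iff.1 (hr0.trans_le hzr)
    have e : dslope f z₀ z * (z - a) = (1 + (z₀ - a) / (z - z₀)) * f z := by
      rw [hfac z hz]
      field_simp
      ring
    rw [e, norm_mul]
    have h3 : ‖1 + (z₀ - a) / (z - z₀)‖ ≤ 1 + ‖z₀ - a‖ / r := by
      refine (norm_add_le _ _).trans ?_
      rw [norm_one, norm_div]
      gcongr
    exact mul_le_mul h3 (hf.bound z hz) (norm_nonneg _) (by positivity)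
  refine ⟨_, ⟨hd, fun z hz => ?_⟩, hfac⟩
  rcases le_total r ‖z - z₀‖ with hzr | hzr
  · exact hfar z hz hzr
  · refine Complex.norm_le_of_forall_mem_frontier_norm_le (U := Metric.ball z₀ r)
      Metric.isBounded_ball (hd.mono (Metric.ball_subset_closedBall.trans hball)) ?_
      (by rw [closure_ball _ hr0.ne']; exact mem_closedBall_iff_norm.2 hzr)
    intro y hy
    rw [frontier_ball _ hr0.ne', mem_sphere_iff_norm] at hy
    exact hfar y (subset_closure (hball (mem_closedBall_iff_norm.2 hy.le))) hy.ge

/-- Cauchy's formula for the upper half-plane. -/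
theorem integral_cauchy_upper {K : ℝ} {f : ℂ → ℂ} (hf : BddAnalytic K upperHalf f) {z a : ℂ}
    (hz : 0 < z.im) (ha : a.im < 0) :
    ∫ x : ℝ, f x / ((x - a) * (x - z)) = 2 * Real.pi * I * f z / (z - a) := by
  obtain ⟨D, -, hD⟩ := exists_div_upper hz ha
  obtain ⟨b, hb, hfb⟩ := hD _ _ (hf.sub (BddAnalytic.const (f z))) (sub_self _)
  -- Subtracting f(z) creates a zero at z; dividing it out trades the pole at z for a second pole at
  -- a, and that part integrates to 0.
  have e : ∀ x : ℝ, f x / ((x - a) * (x - z)) =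
      f z * (1 / (((x : ℂ) - a) * (x - z))) + b x / ((x - a) * (x - a)) := fun x => by
    have h1 := sub_ne_zero_of_im_ne ha.ne x
    have h2 := sub_ne_zero_of_im_ne hz.ne' x
    have := hfb x (ofReal_mem_closure_upperHalf x)
    rw [sub_eq_iff_eq_add.1 this]
    field_simp
    ring
  simp_rw [e]
  rw [integral_add, integral_const_mul, integral_one_div hz ha, integral_div_eq_zero_upper hb ha ha]
  · ring
  · exact (integrable_div (f := fun _ => 1) continuous_const (K := 1) (by simp)
      ha.ne hz.ne').const_mul _
  · exact integrable_div hb.continuous_upper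
      (fun x => hb.bound _ (ofReal_mem_closure_upperHalf x)) ha.ne ha.ne

/-- Cauchy's formula for the lower half-plane. -/
theorem integral_cauchy_lower {K : ℝ} {f : ℂ → ℂ} (hf : BddAnalytic K lowerHalf f) {z a : ℂ}
    (hz : z.im < 0) (ha : 0 < a.im) :
    ∫ x : ℝ, f x / ((x - a) * (x - z)) = -(2 * Real.pi * I * f z / (z - a)) := by
  rw [← integral_neg_eq_self]
  have := integral_cauchy_upper hf.reflect_lower (a := -a) (z := -z) (by simpa) (by simpa)
  rw [neg_neg] at this
  rw [← div_neg, neg_sub]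
  rw [show a - z = -z - -a by ring, ← this]
  congr 1 with x
  push_cast
  congr 1
  ring

/-! ### The Cayley transform -/

/-- The Cayley transform of the upper half-plane onto the unit disc. -/
noncomputable def cayley (z : ℂ) : ℂ := (z - I) / (z + I)

theorem add_I_ne_zero {z : ℂ} (hz : z ∈ closure upperHalf) : z + I ≠ 0 := by
  simpa using sub_ne_zero_of_im_neg (a := -I) (by simp) hz

theorem sub_I_ne_zero {z : ℂ} (hz : z ∈ closure lowerHalf) : z - I ≠ 0 := fun h => by
  rw [closure_lowerHalf, mem_ofPred_eq, sub_eq_zero.1 h, I_im] at hz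
  linarith

/-- This holds at the poles too: division by zero makes `(cayley (-I))⁻¹` equal to 0, the true value
of (z + i)/(z - i) at -i. Hence `(cayley z)⁻¹` needs no exception in the lower half-plane. -/
theorem cayley_neg (z : ℂ) : cayley (-z) = (cayley z)⁻¹ := by
  rw [cayley, cayley, inv_div, ← neg_div_neg_eq]
  ring

theorem normSq_sub_I (z : ℂ) : ‖z - I‖ ^ 2 = ‖z‖ ^ 2 + 1 - 2 * z.im := by
  simp only [← normSq_eq_norm_sq, normSq_apply, sub_re, sub_im, I_re, I_im]
  ring

theorem normSq_add_I (z : ℂ) : ‖z + I‖ ^ 2 = ‖z‖ ^ 2 + 1 + 2 * z.im := by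
  simp only [← normSq_eq_norm_sq, normSq_apply, add_re, add_im, I_re, I_im]
  ring

theorem norm_cayley_le {z : ℂ} (hz : z ∈ closure upperHalf) : ‖cayley z‖ ≤ 1 := by
  rw [cayley, norm_div, div_le_one (norm_pos_iff.2 (add_I_ne_zero hz))]
  rw [closure_upperHalf, mem_ofPred_eq] at hz
  refine le_of_sq_le_sq ?_ (norm_nonneg _)
  rw [normSq_add_I, normSq_sub_I]
  linarith

theorem norm_cayley_lt {z : ℂ} (hz : z ∈ upperHalf) : ‖cayley z‖ < 1 := by
  rw [cayley, norm_div, div_lt_one (norm_pos_iff.2 (add_I_ne_zero (subset_closure hz)))]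
  simp only [upperHalf, mem_ofPred_eq] at hz
  refine lt_of_pow_lt_pow_left₀ 2 (norm_nonneg _) ?_
  rw [normSq_add_I, normSq_sub_I]
  linarith

theorem norm_cayley_ofReal (x : ℝ) : ‖cayley x‖ = 1 := by
  have h := add_I_ne_zero (ofReal_mem_closure_upperHalf x)
  rw [cayley, norm_div, div_eq_one_iff_eq (norm_ne_zero_iff.2 h)]
  rw [← sq_eq_sq₀ (norm_nonneg _) (norm_nonneg _), normSq_add_I, normSq_sub_I]
  simp

theorem cayley_ofReal_ne_zero (x : ℝ) : cayley x ≠ 0 := fun h => by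
  simpa [h] using norm_cayley_ofReal x

theorem bddAnalytic_cayley : BddAnalytic 1 upperHalf cayley :=
  ⟨(differentiable_id.sub_const I).diffContOnCl.smul
    ((differentiable_id.add_const I).diffContOnCl.inv fun _ hz => add_I_ne_zero hz),
    fun _ hz => norm_cayley_le hz⟩

/-! ### Cauchy integrals and moments of a sum of boundary values -/

section Jump

variable {K L : ℝ} {P Q : ℂ → ℂ} {m : ℝ → ℂ}

theorem BddAnalytic.integrable_upper (hP : BddAnalytic K upperHalf P) {a b : ℂ} (ha : a.im ≠ 0)
    (hb : b.im ≠ 0) : Integrable fun x : ℝ => P x / ((x - a) * (x - b)) :=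
  integrable_div hP.continuous_upper (fun x => hP.bound _ (ofReal_mem_closure_upperHalf x)) ha hb

theorem BddAnalytic.integrable_lower (hP : BddAnalytic K lowerHalf P) {a b : ℂ} (ha : a.im ≠ 0)
    (hb : b.im ≠ 0) : Integrable fun x : ℝ => P x / ((x - a) * (x - b)) :=
  integrable_div hP.continuous_lower (fun x => hP.bound _ (ofReal_mem_closure_lowerHalf x)) ha hb

theorem integral_jump (hP : BddAnalytic K upperHalf P) (hQ : BddAnalytic L lowerHalf Q)
    (hm : ∀ x : ℝ, m x = P x + Q x) {a b : ℂ} (ha : a.im ≠ 0) (hb : b.im ≠ 0) :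
    ∫ x : ℝ, m x / ((x - a) * (x - b)) =
      (∫ x : ℝ, P x / ((x - a) * (x - b))) + ∫ x : ℝ, Q x / ((x - a) * (x - b)) := by
  simp_rw [hm, add_div]
  exact integral_add (hP.integrable_upper ha hb) (hQ.integrable_lower ha hb)

/-- Both poles of the kernel lie above, so Q contributes nothing; the factor z - i in front of the
integral normalises the result to vanish at i. -/
theorem omegaPlus_eq (hP : BddAnalytic K upperHalf P) (hQ : BddAnalytic L lowerHalf Q)
    (hm : ∀ x : ℝ, m x = P x + Q x) {z : ℂ} (hz : z ∈ upperHalf) :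
    omegaPlus m z = P z - P I := by
  have hz' : 0 < z.im := hz
  have hI : (-I : ℂ).im < 0 := by simp
  obtain ⟨D, -, hD⟩ := exists_div_upper (z₀ := I) (a := -I) (by simp) hI
  obtain ⟨b, hb, hPb⟩ := hD _ _ (hP.sub (BddAnalytic.const (P I))) (sub_self _)
  -- The zero of P - P(i) cancels the pole at i, leaving one pole on each side of the line, the
  -- situation of Cauchy's formula.
  have e : ∀ x : ℝ, P x / ((x - I) * (x - z)) =
      P I / ((x - I) * (x - z)) + b x / ((x - -I) * (x - z)) := fun x => by
    have h1 := sub_ne_zero_of_im_ne (a := I) (by simp) x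
    have h2 := sub_ne_zero_of_im_ne (a := -I) (by simp) x
    have h3 := sub_ne_zero_of_im_ne hz'.ne' x
    rw [sub_eq_iff_eq_add.1 (hPb x (ofReal_mem_closure_upperHalf x))]
    field_simp
    ring
  have hz0 : z + I ≠ 0 := add_I_ne_zero (subset_closure hz)
  rw [omegaPlus, integral_jump hP hQ hm (by simp) hz'.ne',
    integral_div_eq_zero_lower hQ (by simp) hz']
  simp_rw [e]
  rw [integral_add ((BddAnalytic.const (P I)).integrable_upper (by simp) hz'.ne')
    (hb.integrable_upper (by simp) hz'.ne'), integral_cauchy_upper hb hz' hI,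
    integral_div_eq_zero_lower (BddAnalytic.const (P I)) (by simp) hz',
    hPb z (subset_closure hz), sub_neg_eq_add]
  have : (Real.pi : ℂ) ≠ 0 := ofReal_ne_zero.2 Real.pi_ne_zero
  field_simp
  ring

/-- Now i and z are on opposite sides: P contributes its value at i and Q its value at z. The
constant P(i) is the one that Ω⁺ subtracts. -/
theorem omegaMinus_eq (hP : BddAnalytic K upperHalf P) (hQ : BddAnalytic L lowerHalf Q)
    (hm : ∀ x : ℝ, m x = P x + Q x) {z : ℂ} (hz : z ∈ lowerHalf) :
    omegaMinus m z = Q z + P I := by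
  have hz' : z.im < 0 := hz
  have hz0 : z - I ≠ 0 := sub_I_ne_zero (subset_closure hz)
  have hP' := integral_cauchy_upper hP (z := I) (by simp) hz'
  simp_rw [mul_comm _ ((_ : ℂ) - I)] at hP'
  rw [omegaMinus, integral_jump hP hQ hm (by simp) hz'.ne, hP',
    integral_cauchy_lower hQ hz' (by simp), ← neg_sub z I]
  have : (Real.pi : ℂ) ≠ 0 := ofReal_ne_zero.2 Real.pi_ne_zero
  field_simp
  ring

theorem integral_div_sq_add_one (hP : BddAnalytic K upperHalf P) (hQ : BddAnalytic L lowerHalf Q)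
    (hm : ∀ x : ℝ, m x = P x + Q x) :
    ∫ x : ℝ, m x / ((x : ℂ) ^ 2 + 1) = Real.pi * (P I + Q (-I)) := by
  have e : ∀ x : ℝ, (x : ℂ) ^ 2 + 1 = (x - I) * (x - -I) := fun x => by
    linear_combination I_sq
  have hP' := integral_cauchy_upper hP (z := I) (a := -I) (by simp) (by simp)
  simp_rw [mul_comm _ ((_ : ℂ) - I)] at hP'
  simp_rw [e]
  rw [integral_jump hP hQ hm (by simp) (by simp), hP',
    integral_cauchy_lower hQ (by simp) (by simp)]
  field_simp [I_ne_zero]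
  ring

/-- Since wˢ/(x - i)^(s+1) = 1/((x + i)ˢ(x - i)), only a simple pole at i remains, with residue
b(i)/(2i)ˢ. The term with Q has its poles above and vanishes. -/
theorem integral_moment_upper {K' : ℝ} {b : ℂ → ℂ} (hb : BddAnalytic K' upperHalf b)
    (hQ : BddAnalytic L lowerHalf Q) {s : ℕ} (hs : 1 ≤ s)
    (hm : ∀ x : ℝ, m x = cayley x ^ s * b x + Q x) :
    ∫ x : ℝ, m x / ((x : ℂ) - I) ^ (s + 1) = 2 * Real.pi * I * b I / (2 * I) ^ s := by
  obtain ⟨t, rfl⟩ : ∃ t, s = t + 1 := ⟨s - 1, by omega⟩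
  obtain ⟨D, hD⟩ := bddAnalytic_inv_sub (a := -I) (by simp)
  obtain ⟨E, hE⟩ := bddAnalytic_inv_sub (a := -I) (by simp)
  have hb' := hb.mul (hD.pow t)
  have hQ' := hQ.mul (hE.reflect_upper.pow t)
  -- Two linear factors are kept for the Cauchy kernel and the remaining t are absorbed into b and
  -- Q. The sign (-1)ᵗ arises because the bounded function (z - i)⁻¹ in the lower half-plane is
  -- obtained by reflecting (z + i)⁻¹.
  have e : ∀ x : ℝ, m x / ((x : ℂ) - I) ^ (t + 1 + 1) =
      b x * ((x - -I)⁻¹) ^ t / ((x - -I) * (x - I)) +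
      (-1) ^ t * (Q x * ((-x - -I)⁻¹) ^ t / ((x - I) * (x - I))) := fun x => by
    have h1 := sub_ne_zero_of_im_ne (a := I) (by simp) x
    have h2 := sub_ne_zero_of_im_ne (a := -I) (by simp) x
    rw [sub_neg_eq_add] at *
    have h3 : -(x : ℂ) + I = -1 * (x - I) := by ring
    have h4 : ((-1 * ((x : ℂ) - I))⁻¹) ^ t = (-1) ^ t * ((x - I) ^ t)⁻¹ := by
      rw [mul_inv, mul_pow, inv_pow (x - I : ℂ)]
      norm_num
    have h5 : ((-1 : ℂ) ^ t) * (-1) ^ t = 1 := by rw [← mul_pow]; norm_num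
    rw [sub_neg_eq_add, h3, h4, hm, cayley, div_pow, inv_pow, add_div]
    congr 1
    · field_simp
      ring
    · rw [mul_left_comm (Q x), mul_div_assoc, ← mul_assoc, h5]
      field_simp
      ring
  simp_rw [e]
  rw [integral_add (hb'.integrable_upper (by simp) (by simp))
    ((hQ'.integrable_lower (by simp) (by simp)).const_mul _), integral_const_mul,
    integral_div_eq_zero_lower hQ' (by simp) (by simp),
    integral_cauchy_upper hb' (by simp) (by simp), sub_neg_eq_add, ← two_mul, inv_pow]
  have : (2 * I : ℂ) ≠ 0 := by simp [I_ne_zero]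
  generalize (2 * I : ℂ) = u at *
  field_simp
  ring

/-- Reflection of the upper case; the sign is that of (-x + i)^(s+1) = (-1)^(s+1)(x - i)^(s+1). -/
theorem integral_moment_lower {K' : ℝ} {b : ℂ → ℂ} (hP : BddAnalytic K upperHalf P)
    (hb : BddAnalytic K' lowerHalf b) {s : ℕ} (hs : 1 ≤ s)
    (hm : ∀ x : ℝ, m x = P x + (cayley x)⁻¹ ^ s * b x) :
    ∫ x : ℝ, m x / ((x : ℂ) + I) ^ (s + 1) =
      (-1) ^ (s + 1) * (2 * Real.pi * I * b (-I) / (2 * I) ^ s) := by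
  have := integral_moment_upper (m := fun x => m (-x)) hb.reflect_lower hP.reflect_upper hs
    fun x => by
      have := hm (-x)
      push_cast at this
      rw [this, cayley_neg, inv_inv, add_comm]
  rw [← this, ← integral_const_mul, ← integral_neg_eq_self]
  congr 1 with x
  have e : ((-x : ℝ) : ℂ) + I = -1 * (x - I) := by push_cast; ring
  rw [e, mul_pow]
  rcases neg_one_pow_eq_or ℂ (s + 1) with h | h <;> rw [h] <;> simp [div_neg]

/-- The vanishing of the moments of the jump gives a zero of the analytic part at `i`. -/
theorem exists_factor_upper : ∃ D, 0 ≤ D ∧ ∀ (k : ℕ) (K L : ℝ) (P Q : ℂ → ℂ) (m : ℝ → ℂ),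
    BddAnalytic K upperHalf P → BddAnalytic L lowerHalf Q → (∀ x : ℝ, m x = P x + Q x) →
    (1 ≤ k → P I = 0) →
    (∀ r : ℕ, 1 ≤ r → r + 1 ≤ k → ∫ x : ℝ, m x / ((x : ℂ) - I) ^ (r + 1) = 0) →
    ∃ b, BddAnalytic (D ^ k * K) upperHalf b ∧
      ∀ z ∈ closure upperHalf, P z = cayley z ^ k * b z := by
  obtain ⟨D, hD0, hD⟩ := exists_div_upper (z₀ := I) (a := -I) (by simp) (by simp)
  refine ⟨D, hD0, fun k K L P Q m hP hQ hm h0 hmom => ?_⟩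
  induction k with
  | zero => exact ⟨P, by simpa using hP, by simp⟩
  | succ k ih =>
    obtain ⟨b, hb, hPb⟩ := ih (fun _ => h0 (by omega)) fun r h1 h2 => hmom r h1 (by omega)
    have hbI : b I = 0 := by
      -- The first zero is the hypothesis on P(i); each further one comes from the moment of order
      -- k, a nonzero multiple of b(i).
      rcases Nat.eq_zero_or_pos k with rfl | hk
      · have := hPb I (subset_closure (by simp [upperHalf]))
        rw [h0 (by omega)] at this
        simpa using this.symm
      · have h := integral_moment_upper hb hQ hk (m := m) fun x => by
          rw [hm, hPb x (ofReal_mem_closure_upperHalf x)]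
        rw [hmom k hk le_rfl, eq_comm, div_eq_zero_iff] at h
        simpa [I_ne_zero, Real.pi_ne_zero] using h
    obtain ⟨c, hc, hbc⟩ := hD _ _ hb hbI
    refine ⟨c, by rwa [pow_succ', mul_assoc], fun z hz => ?_⟩
    rw [hPb z hz, hbc z hz, sub_neg_eq_add, pow_succ, mul_assoc]
    rfl

theorem exists_factor_lower : ∃ D, 0 ≤ D ∧ ∀ (k : ℕ) (K L : ℝ) (P Q : ℂ → ℂ) (m : ℝ → ℂ),
    BddAnalytic K upperHalf P → BddAnalytic L lowerHalf Q → (∀ x : ℝ, m x = P x + Q x) →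
    (1 ≤ k → Q (-I) = 0) →
    (∀ r : ℕ, 1 ≤ r → r + 1 ≤ k → ∫ x : ℝ, m x / ((x : ℂ) + I) ^ (r + 1) = 0) →
    ∃ b, BddAnalytic (D ^ k * L) lowerHalf b ∧
      ∀ z ∈ closure lowerHalf, Q z = (cayley z)⁻¹ ^ k * b z := by
  obtain ⟨D, hD0, hD⟩ := exists_factor_upper
  refine ⟨D, hD0, fun k K L P Q m hP hQ hm h0 hmom => ?_⟩
  obtain ⟨b, hb, hQb⟩ := hD k L K (fun z => Q (-z)) (fun z => P (-z)) (fun x => m (-x))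
    hQ.reflect_lower hP.reflect_upper (fun x => by have := hm (-x); push_cast at this; rw [this, add_comm])
    h0 fun r h1 h2 => by
      rw [← integral_neg_eq_self]
      have := hmom r h1 h2
      rw [← neg_eq_zero, ← mul_zero ((-1 : ℂ) ^ r), ← this, ← integral_const_mul, ← integral_neg]
      congr 1 with x
      have e : ((-x : ℝ) : ℂ) - I = -1 * (x + I) := by push_cast; ring
      rw [e, mul_pow, neg_neg, pow_succ (-1 : ℂ)]
      rcases neg_one_pow_eq_or ℂ r with h | h <;> rw [h] <;> simp [div_neg]
  refine ⟨fun z => b (-z), hb.reflect_upper, fun z hz => ?_⟩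
  have := hQb (-z) (by rw [closure_lowerHalf] at hz; rw [closure_upperHalf]; simpa using hz)
  rw [neg_neg, cayley_neg] at this
  exact this

end Jump

/-! ### Integral estimate for the kernel in Privalov's theorem -/

section Kernel

theorem circleMap_add_eq_mul (θ α : ℝ) : circleMap 0 1 (θ + α) = circleMap 0 1 θ * circleMap 0 1 α := by
  simp [circleMap, add_mul, Complex.exp_add]

theorem circleMap_mem (θ : ℝ) : circleMap 0 1 θ ∈ sphere (0 : ℂ) 1 :=
  circleMap_mem_sphere 0 zero_le_one θ

theorem norm_circleMap_one (θ : ℝ) : ‖circleMap 0 1 θ‖ = 1 := by simp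

theorem circleMap_sub_ne_zero {w : ℂ} (hw : ‖w‖ < 1) (θ : ℝ) : circleMap 0 1 θ - w ≠ 0 := fun h => by
  rw [← sub_eq_zero.1 h, norm_circleMap_one] at hw
  exact lt_irrefl _ hw

/-- The kernel controlling the derivative of Cauchy integrals of Hölder functions. -/
noncomputable def holderKernel (μ r : ℝ) (ζ : ℂ) (θ : ℝ) : ℝ :=
  ‖circleMap 0 1 θ - ζ‖ ^ μ / ‖circleMap 0 1 θ - r * ζ‖ ^ 2

variable {μ r : ℝ} {ζ : ℂ}

theorem continuous_holderKernel (hμ : 0 < μ) (hr0 : 0 ≤ r) (hr : r < 1) (hζ : ‖ζ‖ = 1) :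
    Continuous (holderKernel μ r ζ) := by
  unfold holderKernel
  refine Continuous.div ?_ (by fun_prop) fun θ => ?_
  · exact (by fun_prop : Continuous fun θ : ℝ => ‖circleMap 0 1 θ - ζ‖).rpow_const
      fun _ => Or.inr hμ.le
  · exact pow_ne_zero _ (norm_ne_zero_iff.2 (circleMap_sub_ne_zero (by
      rw [norm_mul, hζ, norm_real, Real.norm_of_nonneg hr0, mul_one]; exact hr) θ))

/-- The numerator is absorbed by |e^{iθ} - 1| ≤ 2|e^{iθ} - r|, and the denominator is comparable to
1 - r + |θ|, which leaves the power μ - 2. -/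
theorem holderKernel_le (hμ0 : 0 < μ) (hμ1 : μ < 1) (hr0 : 0 ≤ r) (hr : r < 1) {θ : ℝ} (hθ : |θ| ≤ Real.pi) :
    holderKernel μ r 1 θ ≤ 50 * (1 - r + |θ|) ^ (μ - 2) := by
  rw [holderKernel, mul_one]
  set A := ‖circleMap 0 1 θ - 1‖ with hA
  set B := ‖circleMap 0 1 θ - r‖ with hB
  have h1 : 1 - r ≤ B := by
    have := norm_sub_norm_le (circleMap 0 1 θ) r
    rwa [norm_circleMap_one, norm_real, Real.norm_of_nonneg hr0] at this
  have hB0 : 0 < B := by linarith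
  have h2 : A ≤ 2 * B := by
    have : A ≤ B + ‖(r : ℂ) - 1‖ := by simpa using norm_add_le (circleMap 0 1 θ - r) ((r : ℂ) - 1)
    rw [← ofReal_one, ← ofReal_sub, norm_real, Real.norm_eq_abs, abs_sub_comm, abs_of_pos (by linarith)] at this
    linarith
  have h3 : 2 / Real.pi * |θ| ≤ A := by
    have h := Real.mul_abs_le_abs_sin (x := θ / 2) (by rw [abs_div, abs_two]; linarith)
    rw [abs_div, abs_two] at h
    have e : circleMap 0 1 θ = exp (I * θ) := by simp [circleMap, mul_comm]
    rw [hA, e, norm_exp_I_mul_ofReal_sub_one, norm_mul, Real.norm_two, Real.norm_eq_abs]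
    linarith
  -- Add 1 - r ≤ B to |θ| ≤ (π/2)A ≤ πB ≤ 4B. The final 50 is then 2 · 5², bounding 2^μ · 5^(2-μ).
  have h4 : (1 - r + |θ|) / 5 ≤ B := by
    have : |θ| ≤ Real.pi / 2 * A := by
      rw [div_mul_eq_mul_div, div_le_iff₀ Real.pi_pos] at h3
      linarith
    have := Real.pi_lt_four
    nlinarith [abs_nonneg θ]
  have h5 : 0 < 1 - r + |θ| := by linarith [abs_nonneg θ]
  calc A ^ μ / B ^ 2 ≤ (2 * B) ^ μ / B ^ 2 := by gcongr
    _ = 2 ^ μ * B ^ (μ - 2) := by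
      rw [Real.mul_rpow zero_le_two hB0.le, Real.rpow_sub hB0, Real.rpow_two, mul_div_assoc]
    _ ≤ 2 * ((1 - r + |θ|) / 5) ^ (μ - 2) := by
      refine mul_le_mul ?_ (Real.rpow_le_rpow_of_nonpos (by positivity) h4 (by linarith))
        (by positivity) zero_le_two
      exact (Real.rpow_le_rpow_of_exponent_le one_le_two hμ1.le).trans_eq (Real.rpow_one 2)
    _ = 2 * 5 ^ (2 - μ) * (1 - r + |θ|) ^ (μ - 2) := by
      rw [Real.div_rpow h5.le (by norm_num), ← neg_sub μ 2, Real.rpow_neg (by norm_num)]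
      ring
    _ ≤ 50 * (1 - r + |θ|) ^ (μ - 2) := by
      gcongr
      have : (5 : ℝ) ^ (2 - μ) ≤ 5 ^ (2 : ℝ) :=
        Real.rpow_le_rpow_of_exponent_le (by norm_num) (by linarith)
      norm_num at this
      linarith

theorem integral_add_rpow_le (hμ1 : μ < 1) {δ : ℝ} (hδ : 0 < δ) :
    ∫ θ in (0 : ℝ)..Real.pi, (δ + θ) ^ (μ - 2) ≤ δ ^ (μ - 1) / (1 - μ) := by
  rw [intervalIntegral.integral_comp_add_left (fun θ => θ ^ (μ - 2)), integral_rpow]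
  · rw [add_zero, show μ - 2 + 1 = -(1 - μ) by ring, div_neg, ← neg_div, neg_sub,
      show -(1 - μ) = μ - 1 by ring]
    have : 0 < 1 - μ := by linarith
    gcongr
    linarith [Real.rpow_nonneg (add_pos hδ Real.pi_pos).le (μ - 1)]
  · right
    refine ⟨by linarith, ?_⟩
    rw [uIcc_of_le (by linarith [Real.pi_pos])]
    rintro ⟨h, -⟩
    linarith

/-- Rotation reduces to ζ = 1, periodicity moves the interval to [-π, π], and the majorant is even;
the integral of (1 - r + θ)^(μ-2) over θ ≥ 0 produces (1 - r)^(μ-1)/(1 - μ). -/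
theorem integral_holderKernel_le (hμ0 : 0 < μ) (hμ1 : μ < 1) (hr0 : 0 ≤ r) (hr : r < 1)
    (hζ : ‖ζ‖ = 1) :
    ∫ θ in (0 : ℝ)..2 * Real.pi, holderKernel μ r ζ θ ≤ 100 / (1 - μ) * (1 - r) ^ (μ - 1) := by
  obtain ⟨α, hα⟩ : ∃ α : ℝ, circleMap 0 1 α = ζ := by
    have : ζ ∈ range (circleMap 0 1) := by rw [range_circleMap]; simp [hζ]
    exact this
  have hshift : ∀ θ, holderKernel μ r ζ (θ + α) = holderKernel μ r 1 θ := fun θ => by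
    rw [holderKernel, holderKernel, circleMap_add_eq_mul, hα]
    have e1 : circleMap 0 1 θ * ζ - ζ = (circleMap 0 1 θ - 1) * ζ := by ring
    have e2 : circleMap 0 1 θ * ζ - r * ζ = (circleMap 0 1 θ - r * 1) * ζ := by ring
    rw [e1, e2, norm_mul, norm_mul, hζ, mul_one, mul_one]
  have hper : Function.Periodic (holderKernel μ r ζ) (2 * Real.pi) := fun θ => by
    rw [holderKernel, holderKernel, periodic_circleMap]
  have e : ∫ θ in (0 : ℝ)..2 * Real.pi, holderKernel μ r ζ θ =
      ∫ θ in (-Real.pi)..Real.pi, holderKernel μ r 1 θ := by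
    have := hper.intervalIntegral_add_eq 0 (-Real.pi + α)
    rw [zero_add] at this
    rw [this, ← intervalIntegral.integral_congr (fun θ _ => hshift θ),
      intervalIntegral.integral_comp_add_right (holderKernel μ r ζ)]
    congr 1
    ring
  have hδ : 0 < 1 - r := by linarith
  have hc : Continuous fun θ : ℝ => 50 * (1 - r + |θ|) ^ (μ - 2) :=
    continuous_const.mul ((by fun_prop : Continuous fun θ : ℝ => 1 - r + |θ|).rpow_const
      fun θ => Or.inl (by linarith [abs_nonneg θ]))
  have hpi := Real.pi_pos
  have h0 : ∫ θ in (0 : ℝ)..Real.pi, 50 * (1 - r + |θ|) ^ (μ - 2) ≤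
      50 * ((1 - r) ^ (μ - 1) / (1 - μ)) := by
    rw [intervalIntegral.integral_const_mul]
    gcongr
    rw [intervalIntegral.integral_congr (g := fun θ => (1 - r + θ) ^ (μ - 2))]
    · exact integral_add_rpow_le hμ1 hδ
    · intro θ hθ
      rw [uIcc_of_le hpi.le] at hθ
      simp only [abs_of_nonneg hθ.1]
  rw [e]
  calc ∫ θ in (-Real.pi)..Real.pi, holderKernel μ r 1 θ
      ≤ ∫ θ in (-Real.pi)..Real.pi, 50 * (1 - r + |θ|) ^ (μ - 2) :=
        intervalIntegral.integral_mono_on (by linarith)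
          ((continuous_holderKernel hμ0 hr0 hr norm_one).intervalIntegrable _ _)
          (hc.intervalIntegrable _ _) fun θ hθ => holderKernel_le hμ0 hμ1 hr0 hr (abs_le.2 hθ)
    _ = 2 * ∫ θ in (0 : ℝ)..Real.pi, 50 * (1 - r + |θ|) ^ (μ - 2) := by
      rw [← intervalIntegral.integral_add_adjacent_intervals (b := 0) (hc.intervalIntegrable _ _)
        (hc.intervalIntegrable _ _), two_mul]
      congr 1
      rw [← neg_zero, ← intervalIntegral.integral_comp_neg, neg_zero]
      simp
    _ ≤ 2 * (50 * ((1 - r) ^ (μ - 1) / (1 - μ))) := by gcongr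
    _ = _ := by ring

end Kernel

/-! ### From growth of the derivative to Hölder continuity in the closed disc -/

section HardyLittlewood

variable {μ A : ℝ} {F : ℂ → ℂ}

theorem norm_sub_radial_le (hμ0 : 0 < μ) (hF : DifferentiableOn ℂ F (ball 0 1))
    (hd : ∀ w ∈ ball (0 : ℂ) 1, ‖deriv F w‖ ≤ A * (1 - ‖w‖) ^ (μ - 1)) (hμ1 : μ < 1) {w : ℂ}
    (hw : w ∈ ball (0 : ℂ) 1) {s : ℝ} (hs0 : 0 ≤ s) (hs1 : s ≤ 1) :
    ‖F w - F (s * w)‖ ≤ A / μ * (1 - s) ^ μ := by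
  have hA : 0 ≤ A := by simpa using (norm_nonneg _).trans (hd 0 (by simp))
  have hw1 : ‖w‖ < 1 := by simpa using hw
  have hmem : ∀ t ∈ Icc s 1, (t : ℂ) * w ∈ ball (0 : ℂ) 1 := fun t ht => by
    rw [mem_ball_zero_iff, norm_mul, norm_real, Real.norm_of_nonneg (hs0.trans ht.1)]
    exact (mul_le_of_le_one_left (norm_nonneg _) ht.2).trans_lt hw1
  have hder : ∀ t ∈ Icc s 1, HasDerivAt (fun t : ℝ => F (t * w) - F (s * w))
      (deriv F (t * w) * w) t := fun t ht => by
    have h1 : HasDerivAt F (deriv F (t * w)) ((t : ℂ) * w) :=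
      (hF.differentiableAt (isOpen_ball.mem_nhds (hmem t ht))).hasDerivAt
    have h2 : HasDerivAt (fun z : ℂ => z * w) w (t : ℂ) := by
      simpa using (hasDerivAt_id (t : ℂ)).mul_const w
    exact (h1.comp (t : ℂ) h2).comp_ofReal.sub_const _
  -- On the radius, 1 - |tw| ≥ 1 - t, so the increment is compared with the integral of A(1 -
  -- t)^(μ-1) from s, which is the barrier B. Its derivative is needed only for t < 1.
  have := image_norm_le_of_norm_deriv_right_le_deriv_boundary' (a := s) (b := 1)
    (f := fun t : ℝ => F (t * w) - F (s * w)) (f' := fun t => deriv F (t * w) * w)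
    (B := fun t => A / μ * ((1 - s) ^ μ - (1 - t) ^ μ)) (B' := fun t => A * (1 - t) ^ (μ - 1))
    (fun t ht => (hder t ht).continuousAt.continuousWithinAt)
    (fun t ht => (hder t (Ico_subset_Icc_self ht)).hasDerivWithinAt) (by simp) ?_ ?_ ?_
    (right_mem_Icc.2 hs1)
  · simpa [hμ0.ne'] using this
  · exact (continuous_const.mul (continuous_const.sub ((continuous_const.sub
      continuous_id).rpow_const fun _ => Or.inr hμ0.le))).continuousOn
  · intro t ht
    have h1 : HasDerivAt (fun t : ℝ => (1 - t) ^ μ) (-1 * μ * (1 - t) ^ (μ - 1)) t :=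
      ((hasDerivAt_id t).const_sub 1).rpow_const (Or.inl (by simpa using (sub_pos.2 ht.2).ne'))
    have h2 := (h1.const_sub ((1 - s) ^ μ)).const_mul (A / μ)
    refine HasDerivAt.hasDerivWithinAt ?_
    have e : A / μ * -(-1 * μ * (1 - t) ^ (μ - 1)) = A * (1 - t) ^ (μ - 1) := by
      rw [neg_one_mul, neg_mul, neg_neg, ← mul_assoc, div_mul_cancel₀ _ hμ0.ne']
    rwa [e] at h2
  · intro t ht
    have ht0 := hs0.trans ht.1
    have ht1 : 0 < 1 - t := sub_pos.2 ht.2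
    have hle : 1 - t ≤ 1 - ‖(t : ℂ) * w‖ := by
      rw [norm_mul, norm_real, Real.norm_of_nonneg ht0]
      linarith [mul_le_of_le_one_right ht0 hw1.le]
    rw [norm_mul]
    refine (mul_le_of_le_one_right (norm_nonneg _) hw1.le).trans
      ((hd _ (hmem t (Ico_subset_Icc_self ht))).trans ?_)
    gcongr A * ?_
    exact Real.rpow_le_rpow_of_nonpos ht1 hle (by linarith)

/-- The Hardy–Littlewood theorem: the growth of the derivative gives Hölder continuity. -/
theorem norm_sub_le_of_norm_deriv_le (hμ0 : 0 < μ) (hμ1 : μ < 1)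
    (hF : DifferentiableOn ℂ F (ball 0 1))
    (hd : ∀ w ∈ ball (0 : ℂ) 1, ‖deriv F w‖ ≤ A * (1 - ‖w‖) ^ (μ - 1)) {v w : ℂ}
    (hv : v ∈ ball (0 : ℂ) 1) (hw : w ∈ ball (0 : ℂ) 1) :
    ‖F v - F w‖ ≤ A * (2 / μ + 1) * ‖v - w‖ ^ μ := by
  have hA : 0 ≤ A := by simpa using (norm_nonneg _).trans (hd 0 (by simp))
  have hpos := Real.rpow_nonneg (norm_nonneg (v - w)) μ
  -- For distant points the path goes through 0. For d = |v - w| < 1 it goes radially from v to (1 -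
  -- d)v, straight to (1 - d)w, and out to w; the middle piece lies where the derivative is at most
  -- A d^(μ-1), so every piece costs a multiple of d^μ.
  rcases le_or_gt 1 ‖v - w‖ with h | h
  · have h1 : 1 ≤ ‖v - w‖ ^ μ := Real.one_le_rpow h hμ0.le
    have hv' := norm_sub_radial_le hμ0 hF hd hμ1 hv le_rfl zero_le_one
    have hw' := norm_sub_radial_le hμ0 hF hd hμ1 hw le_rfl zero_le_one
    simp only [ofReal_zero, zero_mul, sub_zero, Real.one_rpow, mul_one] at hv' hw'
    have : ‖F v - F w‖ ≤ ‖F v - F 0‖ + ‖F w - F 0‖ := by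
      simpa using norm_sub_le (F v - F 0) (F w - F 0)
    calc ‖F v - F w‖ ≤ A * (2 / μ + 1) * 1 := by
          rw [mul_one, mul_add, mul_one]
          have : A / μ + A / μ = A * (2 / μ) := by ring
          linarith
      _ ≤ _ := by gcongr
  · rcases eq_or_ne v w with rfl | hne
    · simp only [sub_self, norm_zero]; positivity
    set d := ‖v - w‖ with hd'
    have hd0 : 0 < d := norm_pos_iff.2 (sub_ne_zero.2 hne)
    have hs0 : 0 ≤ 1 - d := by linarith
    have hv' := norm_sub_radial_le hμ0 hF hd hμ1 hv hs0 (by linarith)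
    have hw' := norm_sub_radial_le hμ0 hF hd hμ1 hw hs0 (by linarith)
    rw [sub_sub_cancel] at hv' hw'
    have hmem : ∀ u ∈ ball (0 : ℂ) 1, ((1 - d : ℝ) : ℂ) * u ∈ closedBall (0 : ℂ) (1 - d) :=
      fun u hu => by
        rw [mem_closedBall_zero_iff, norm_mul, norm_real, Real.norm_of_nonneg hs0]
        exact mul_le_of_le_one_right hs0 (mem_ball_zero_iff.1 hu).le
    have hsub : closedBall (0 : ℂ) (1 - d) ⊆ ball 0 1 := closedBall_subset_ball (by linarith)
    have hmid := (convex_closedBall (0 : ℂ) (1 - d)).norm_image_sub_le_of_norm_deriv_le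
      (f := F) (C := A * d ^ (μ - 1))
      (fun x hx => hF.differentiableAt (isOpen_ball.mem_nhds (hsub hx))) (fun x hx => by
        refine (hd x (hsub hx)).trans ?_
        gcongr A * ?_
        refine Real.rpow_le_rpow_of_nonpos hd0 ?_ (by linarith)
        linarith [mem_closedBall_zero_iff.1 hx]) (hmem w hw) (hmem v hv)
    have e1 : ‖((1 - d : ℝ) : ℂ) * v - ((1 - d : ℝ) : ℂ) * w‖ ≤ d := by
      rw [← mul_sub, norm_mul, norm_real, Real.norm_of_nonneg hs0]
      exact mul_le_of_le_one_left (norm_nonneg _) (by linarith)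
    have e2 : A * d ^ (μ - 1) * d = A * d ^ μ := by
      rw [mul_assoc, Real.rpow_sub_one hd0.ne', div_mul_cancel₀ _ hd0.ne']
    have hmid' := hmid.trans (mul_le_mul_of_nonneg_left e1 (by positivity))
    rw [e2] at hmid'
    have e3 : F v - F w = (F v - F (((1 - d : ℝ) : ℂ) * v)) +
        (F (((1 - d : ℝ) : ℂ) * v) - F (((1 - d : ℝ) : ℂ) * w)) -
        (F w - F (((1 - d : ℝ) : ℂ) * w)) := by ring
    rw [e3]
    refine (norm_sub_le _ _).trans ((add_le_add_left (norm_add_le _ _) _).trans ?_)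
    have : A * (2 / μ + 1) * d ^ μ = A / μ * d ^ μ + A * d ^ μ + A / μ * d ^ μ := by ring
    linarith

/-- Hölder functions on the disc extend to the closed disc. -/
theorem exists_extension_closedBall {C : ℝ} (hμ0 : 0 < μ)
    (hF : DifferentiableOn ℂ F (ball 0 1))
    (h : ∀ v ∈ ball (0 : ℂ) 1, ∀ w ∈ ball (0 : ℂ) 1, ‖F v - F w‖ ≤ C * ‖v - w‖ ^ μ) :
    ∃ G : ℂ → ℂ, DiffContOnCl ℂ G (ball 0 1) ∧ EqOn G F (ball 0 1) ∧
      ∀ v ∈ closedBall (0 : ℂ) 1, ∀ w ∈ closedBall (0 : ℂ) 1, ‖G v - G w‖ ≤ C * ‖v - w‖ ^ μ := by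
  have huc : UniformContinuousOn F (ball 0 1) := by
    rw [Metric.uniformContinuousOn_iff]
    intro ε hε
    have hlim : Tendsto (fun d : ℝ => C * d ^ μ) (𝓝 0) (𝓝 0) := by
      have : Continuous fun d : ℝ => C * d ^ μ :=
        continuous_const.mul (continuous_id.rpow_const fun _ => Or.inr hμ0.le)
      simpa [hμ0.ne'] using this.tendsto 0
    obtain ⟨δ, hδ, hδε⟩ := Metric.eventually_nhds_iff.1 (hlim.eventually (gt_mem_nhds hε))
    refine ⟨δ, hδ, fun v hv w hw hvw => ?_⟩
    rw [dist_eq_norm] at hvw ⊢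
    exact (h v hv w hw).trans_lt (hδε (by simpa using hvw))
  have hcl : closure (ball (0 : ℂ) 1) = closedBall 0 1 := closure_ball _ one_ne_zero
  have hlim : ∀ x ∈ closedBall (0 : ℂ) 1, ∃ y, Tendsto F (𝓝[ball 0 1] x) (𝓝 y) := by
    intro x hx
    rw [← hcl] at hx
    have := mem_closure_iff_nhdsWithin_neBot.1 hx
    refine cauchy_map_iff_exists_tendsto.1 (cauchy_map_iff'.2 (huc.mono_left (le_inf ?_ ?_)))
    · exact (cauchy_nhds.mono nhdsWithin_le_nhds).2
    · rw [← prod_principal_principal]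
      exact prod_mono inf_le_right inf_le_right
  have hG : ContinuousOn (extendFrom (ball 0 1) F) (closedBall 0 1) :=
    continuousOn_extendFrom hcl.ge hlim
  have heq : EqOn (extendFrom (ball 0 1) F) F (ball 0 1) := fun x hx =>
    extendFrom_eq (subset_closure hx) (hF.continuousOn x hx)
  refine ⟨extendFrom (ball 0 1) F, ⟨hF.congr heq, by rwa [hcl]⟩, heq, ?_⟩
  -- The Hölder bound passes to boundary points along radii.
  have hr : ∀ᶠ r : ℝ in 𝓝[<] 1, r ∈ Ioo 0 1 := Ioo_mem_nhdsLT one_pos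
  have hrv : ∀ r ∈ Ioo (0 : ℝ) 1, ∀ v ∈ closedBall (0 : ℂ) 1, (r : ℂ) * v ∈ ball (0 : ℂ) 1 :=
    fun r hr v hv => by
      rw [mem_ball_zero_iff, norm_mul, norm_real, Real.norm_of_nonneg hr.1.le]
      exact (mul_le_of_le_one_right hr.1.le (mem_closedBall_zero_iff.1 hv)).trans_lt hr.2
  have hmul : ∀ v : ℂ, Tendsto (fun r : ℝ => (r : ℂ) * v) (𝓝[<] 1) (𝓝 v) := fun v => by
    have : Continuous fun r : ℝ => (r : ℂ) * v := by fun_prop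
    simpa using (this.tendsto 1).mono_left nhdsWithin_le_nhds
  have hrad : ∀ v ∈ closedBall (0 : ℂ) 1, Tendsto (fun r : ℝ => F (r * v)) (𝓝[<] 1)
      (𝓝 (extendFrom (ball 0 1) F v)) := fun v hv =>
    (tendsto_extendFrom (hlim v hv)).comp (tendsto_nhdsWithin_iff.2
      ⟨hmul v, hr.mono fun r hr => hrv r hr v hv⟩)
  intro v hv w hw
  have hR : Tendsto (fun r : ℝ => C * ‖(r : ℂ) * v - r * w‖ ^ μ) (𝓝[<] 1) (𝓝 (C * ‖v - w‖ ^ μ)) :=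
    (((hmul v).sub (hmul w)).norm.rpow_const (Or.inr hμ0.le)).const_mul C
  exact le_of_tendsto_of_tendsto ((hrad v hv).sub (hrad w hw)).norm hR
    (hr.mono fun r hr => h _ (hrv r hr v hv) _ (hrv r hr w hw))

end HardyLittlewood

/-! ### Privalov's theorem and the jump relation on the circle -/

/-- The Cauchy integral of a function on the unit circle, in polar coordinates. -/
noncomputable def cauchyDisc (φ : ℂ → ℂ) (w : ℂ) : ℂ :=
  (2 * Real.pi : ℂ)⁻¹ * ∫ θ in (0 : ℝ)..2 * Real.pi,
    circleMap 0 1 θ / (circleMap 0 1 θ - w) * φ (circleMap 0 1 θ)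

/-- `φ` is bounded by `K` and Hölder continuous with constant `K` on the unit circle. -/
structure HolderCircle (μ K : ℝ) (φ : ℂ → ℂ) : Prop where
  bound : ∀ t ∈ sphere (0 : ℂ) 1, ‖φ t‖ ≤ K
  holder : ∀ s ∈ sphere (0 : ℂ) 1, ∀ t ∈ sphere (0 : ℂ) 1, ‖φ s - φ t‖ ≤ K * ‖s - t‖ ^ μ

section Disc

variable {μ K : ℝ} {φ : ℂ → ℂ} {w : ℂ}

theorem HolderCircle.continuousOn (hφ : HolderCircle μ K φ) (hμ0 : 0 < μ) :
    ContinuousOn φ (sphere 0 1) := by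
  intro t ht
  rw [ContinuousWithinAt, tendsto_iff_norm_sub_tendsto_zero]
  refine squeeze_zero' (Eventually.of_forall fun _ => norm_nonneg _)
    (eventually_mem_nhdsWithin.mono fun s hs => hφ.holder s hs t ht) ?_
  have : Continuous fun s : ℂ => K * ‖s - t‖ ^ μ :=
    continuous_const.mul ((by fun_prop : Continuous fun s : ℂ => ‖s - t‖).rpow_const
      fun _ => Or.inr hμ0.le)
  simpa [hμ0.ne'] using (this.tendsto t).mono_left nhdsWithin_le_nhds

theorem HolderCircle.conj (hφ : HolderCircle μ K φ) :
    HolderCircle μ K fun t => φ ((starRingEnd ℂ) t) := by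
  have h : ∀ t ∈ sphere (0 : ℂ) 1, (starRingEnd ℂ) t ∈ sphere (0 : ℂ) 1 := fun t ht => by
    simpa using ht
  refine ⟨fun t ht => hφ.bound _ (h t ht), fun s hs t ht => ?_⟩
  have := hφ.holder _ (h s hs) _ (h t ht)
  rwa [← map_sub, RCLike.norm_conj] at this

theorem continuous_comp_circleMap (hφ : ContinuousOn φ (sphere 0 1)) :
    Continuous fun θ : ℝ => φ (circleMap 0 1 θ) :=
  hφ.comp_continuous (continuous_circleMap 0 1) circleMap_mem

theorem continuous_cauchyKernel (hw : ‖w‖ < 1) :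
    Continuous fun θ : ℝ => circleMap 0 1 θ / (circleMap 0 1 θ - w) :=
  (continuous_circleMap 0 1).div (by fun_prop) (circleMap_sub_ne_zero hw)

theorem cauchyDisc_eq (φ : ℂ → ℂ) (w : ℂ) :
    cauchyDisc φ w = (2 * Real.pi * I : ℂ)⁻¹ • ∮ z in C(0, 1), (z - w)⁻¹ • φ z := by
  rw [circleIntegral, cauchyDisc, mul_inv _ I, smul_eq_mul, mul_assoc]
  congr 1
  rw [← intervalIntegral.integral_const_mul]
  congr 1 with θ
  rw [deriv_circleMap, smul_eq_mul, smul_eq_mul]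
  field_simp [I_ne_zero]

theorem cauchyDisc_const (c : ℂ) (hw : ‖w‖ < 1) : cauchyDisc (fun _ => c) w = c := by
  rw [cauchyDisc_eq]
  simp only [smul_eq_mul]
  have h : ∮ z in C(0, 1), (z - w)⁻¹ * c = (∮ z in C(0, 1), (z - w)⁻¹) * c := by
    simpa using circleIntegral.integral_smul_const (fun z => (z - w)⁻¹) c 0 1
  rw [h, circleIntegral.integral_sub_inv_of_mem_ball (by simpa using hw)]
  have : (Real.pi : ℂ) ≠ 0 := ofReal_ne_zero.2 Real.pi_ne_zero
  field_simp [I_ne_zero]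

theorem cauchyDisc_sub_const (hφ : ContinuousOn φ (sphere 0 1)) (c : ℂ) (hw : ‖w‖ < 1) :
    cauchyDisc (fun t => φ t - c) w = cauchyDisc φ w - c := by
  nth_rw 2 [← cauchyDisc_const c hw]
  rw [cauchyDisc, cauchyDisc, cauchyDisc, ← mul_sub, ← intervalIntegral.integral_sub]
  · simp_rw [mul_sub]
  · exact ((continuous_cauchyKernel hw).mul (continuous_comp_circleMap hφ)).intervalIntegrable _ _
  · exact ((continuous_cauchyKernel hw).mul continuous_const).intervalIntegrable _ _

theorem differentiableOn_cauchyDisc (hφ : ContinuousOn φ (sphere 0 1)) :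
    DifferentiableOn ℂ (cauchyDisc φ) (ball 0 1) := by
  have h := (hasFPowerSeriesOn_cauchy_integral (f := φ) (c := 0) (R := 1)
    (hφ.circleIntegrable (by simp)) one_pos).differentiableOn
  have e : Metric.eball (0 : ℂ) ((1 : NNReal) : ENNReal) = ball 0 1 := by
    rw [Metric.eball_coe]; rfl
  rw [e] at h
  exact h.congr fun w _ => cauchyDisc_eq φ w

theorem two_pi_norm : ‖(2 * Real.pi : ℂ)⁻¹‖ = (2 * Real.pi)⁻¹ := by
  rw [norm_inv, norm_mul, norm_real, norm_ofNat, Real.norm_of_nonneg Real.pi_pos.le]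

theorem norm_cauchyDisc_zero_le (hφ : HolderCircle μ K φ) : ‖cauchyDisc φ 0‖ ≤ K := by
  have h : ‖∫ θ in (0 : ℝ)..2 * Real.pi,
      circleMap 0 1 θ / (circleMap 0 1 θ - 0) * φ (circleMap 0 1 θ)‖ ≤ K * |2 * Real.pi - 0| := by
    refine intervalIntegral.norm_integral_le_of_norm_le_const fun θ _ => ?_
    rw [norm_mul, norm_div, sub_zero, norm_circleMap_one, div_one, one_mul]
    exact hφ.bound _ (circleMap_mem θ)
  have hpi := Real.pi_pos
  rw [sub_zero, abs_of_pos (by positivity)] at h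
  rw [cauchyDisc, norm_mul, two_pi_norm, inv_mul_le_iff₀ (by positivity)]
  linarith

/-- A point of the disc is a multiple of a point of the circle. -/
theorem exists_polar (w : ℂ) : ∃ ζ : ℂ, ‖ζ‖ = 1 ∧ w = ‖w‖ * ζ := by
  rcases eq_or_ne w 0 with rfl | h
  · exact ⟨1, by simp, by simp⟩
  · have : (‖w‖ : ℂ) ≠ 0 := by simpa using h
    refine ⟨w / ‖w‖, by simp [h], by field_simp⟩

/-- Constants are reproduced, so φ may be replaced by φ - φ(ζ) with ζ the radial projection of w.
The kernels differ by t(v - w)/((t - v)(t - w)), and |t - w| ≤ 2|t - v| because v is close to w;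
this leaves `holderKernel`. The local Lipschitz form yields the derivative bound without
differentiating the integral. -/
theorem norm_cauchyDisc_sub_le (hφ : HolderCircle μ K φ) (hμ0 : 0 < μ) (hμ1 : μ < 1)
    (hw : ‖w‖ < 1) {v : ℂ} (hv : ‖v - w‖ ≤ (1 - ‖w‖) / 2) :
    ‖cauchyDisc φ v - cauchyDisc φ w‖ ≤
      K * (100 / (1 - μ)) * (1 - ‖w‖) ^ (μ - 1) * ‖v - w‖ := by
  obtain ⟨ζ, hζ, hwζ⟩ := exists_polar w
  have hv1 : ‖v‖ < 1 := by
    have : ‖v‖ ≤ ‖v - w‖ + ‖w‖ := by simpa using norm_add_le (v - w) w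
    linarith
  have hK : 0 ≤ K := (norm_nonneg _).trans (hφ.bound ζ (by simpa using hζ))
  have hcont := hφ.continuousOn hμ0
  have hc := continuous_comp_circleMap hcont
  rw [← sub_sub_sub_cancel_right _ _ (φ ζ), ← cauchyDisc_sub_const hcont _ hv1,
    ← cauchyDisc_sub_const hcont _ hw, cauchyDisc, cauchyDisc, ← mul_sub,
    ← intervalIntegral.integral_sub, norm_mul, two_pi_norm]
  rotate_left
  · exact ((continuous_cauchyKernel hv1).mul (hc.sub continuous_const)).intervalIntegrable _ _
  · exact ((continuous_cauchyKernel hw).mul (hc.sub continuous_const)).intervalIntegrable _ _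
  have hpi := Real.pi_pos
  have hker := continuous_holderKernel hμ0 (norm_nonneg w) hw hζ
  have key : ‖∫ θ in (0 : ℝ)..2 * Real.pi,
      (circleMap 0 1 θ / (circleMap 0 1 θ - v) * (φ (circleMap 0 1 θ) - φ ζ) -
        circleMap 0 1 θ / (circleMap 0 1 θ - w) * (φ (circleMap 0 1 θ) - φ ζ))‖ ≤
      ∫ θ in (0 : ℝ)..2 * Real.pi, 2 * K * ‖v - w‖ * holderKernel μ ‖w‖ ζ θ := by
    refine intervalIntegral.norm_integral_le_of_norm_le (by positivity)
      (Eventually.of_forall fun θ _ => ?_) ((continuous_const.mul hker).intervalIntegrable _ _)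
    have h1 := circleMap_sub_ne_zero hv1 θ
    have h2 := circleMap_sub_ne_zero hw θ
    have hn1 := norm_pos_iff.2 h1
    have hn2 := norm_pos_iff.2 h2
    have e : circleMap 0 1 θ / (circleMap 0 1 θ - v) * (φ (circleMap 0 1 θ) - φ ζ) -
        circleMap 0 1 θ / (circleMap 0 1 θ - w) * (φ (circleMap 0 1 θ) - φ ζ) =
        circleMap 0 1 θ * (v - w) * (φ (circleMap 0 1 θ) - φ ζ) /
          ((circleMap 0 1 θ - v) * (circleMap 0 1 θ - w)) := by
      field_simp
      ring
    have h3 : ‖circleMap 0 1 θ - w‖ ≤ 2 * ‖circleMap 0 1 θ - v‖ := by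
      have a1 : ‖circleMap 0 1 θ - w‖ ≤ ‖circleMap 0 1 θ - v‖ + ‖v - w‖ := by
        simpa using norm_add_le (circleMap 0 1 θ - v) (v - w)
      have a2 := norm_sub_norm_le (circleMap 0 1 θ) w
      rw [norm_circleMap_one] at a2
      linarith
    have h4 := hφ.holder _ (circleMap_mem θ) ζ (by simpa using hζ)
    rw [e, norm_div, norm_mul, norm_mul, norm_mul, norm_circleMap_one, one_mul, holderKernel, ← hwζ,
      ← mul_div_assoc, div_le_div_iff₀ (by positivity) (by positivity)]
    calc ‖v - w‖ * ‖φ (circleMap 0 1 θ) - φ ζ‖ * ‖circleMap 0 1 θ - w‖ ^ 2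
        = ‖v - w‖ * ‖φ (circleMap 0 1 θ) - φ ζ‖ *
          (‖circleMap 0 1 θ - w‖ * ‖circleMap 0 1 θ - w‖) := by ring
      _ ≤ ‖v - w‖ * (K * ‖circleMap 0 1 θ - ζ‖ ^ μ) *
          (2 * ‖circleMap 0 1 θ - v‖ * ‖circleMap 0 1 θ - w‖) := by gcongr
      _ = _ := by ring
  have hI := integral_holderKernel_le hμ0 hμ1 (norm_nonneg w) hw hζ
  rw [intervalIntegral.integral_const_mul] at key
  calc (2 * Real.pi)⁻¹ * _ ≤ 1 / 2 * (2 * K * ‖v - w‖ *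
        (100 / (1 - μ) * (1 - ‖w‖) ^ (μ - 1))) := by
        refine mul_le_mul ?_ (key.trans (by gcongr)) (norm_nonneg _) (by norm_num)
        rw [one_div]
        exact inv_anti₀ two_pos (by linarith [Real.pi_gt_three])
    _ = _ := by ring

theorem norm_deriv_cauchyDisc_le (hφ : HolderCircle μ K φ) (hμ0 : 0 < μ) (hμ1 : μ < 1)
    (hw : w ∈ ball (0 : ℂ) 1) :
    ‖deriv (cauchyDisc φ) w‖ ≤ K * (100 / (1 - μ)) * (1 - ‖w‖) ^ (μ - 1) := by
  have hw' : ‖w‖ < 1 := by simpa using hw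
  have hK : 0 ≤ K := (norm_nonneg _).trans (hφ.bound 1 (by simp))
  have h1 : 0 < 1 - μ := by linarith
  have h2 : 0 < 1 - ‖w‖ := by linarith
  refine ((differentiableOn_cauchyDisc (hφ.continuousOn hμ0)).differentiableAt
    (isOpen_ball.mem_nhds hw)).hasDerivAt.le_of_lip' (by positivity) ?_
  filter_upwards [closedBall_mem_nhds w (half_pos h2)] with v hv
  exact norm_cauchyDisc_sub_le hφ hμ0 hμ1 hw' (mem_closedBall_iff_norm.1 hv)

/-- The constant of the boundedness of Cauchy integrals on Hölder functions. -/
noncomputable def privalovConst (μ : ℝ) : ℝ := 100 / (1 - μ) * (2 / μ + 1)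

theorem privalovConst_pos (hμ0 : 0 < μ) (hμ1 : μ < 1) : 0 < privalovConst μ := by
  have h1 : 0 < 1 - μ := by linarith
  rw [privalovConst]
  positivity

/-- Privalov's theorem: Cauchy integrals of Hölder functions are Hölder in the closed disc. -/
theorem exists_cauchyDisc_extension (hφ : HolderCircle μ K φ) (hμ0 : 0 < μ) (hμ1 : μ < 1) :
    ∃ G : ℂ → ℂ, DiffContOnCl ℂ G (ball 0 1) ∧ EqOn G (cauchyDisc φ) (ball 0 1) ∧
      ∀ v ∈ closedBall (0 : ℂ) 1, ∀ w ∈ closedBall (0 : ℂ) 1,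
        ‖G v - G w‖ ≤ K * privalovConst μ * ‖v - w‖ ^ μ := by
  have hd := differentiableOn_cauchyDisc (hφ.continuousOn hμ0)
  refine exists_extension_closedBall hμ0 hd fun v hv w hw => ?_
  have := norm_sub_le_of_norm_deriv_le hμ0 hμ1 hd
    (fun w hw => norm_deriv_cauchyDisc_le hφ hμ0 hμ1 hw) hv hw
  rwa [mul_assoc K] at this

/-- On the circle conjugation is t ↦ 1/t. This interior integral is the exterior Cauchy integral
carried into the disc by u ↦ 1/u, plus the mean `cauchyDisc φ 0`. -/
theorem cauchyDisc_conj (φ : ℂ → ℂ) (w : ℂ) :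
    cauchyDisc (fun t => φ ((starRingEnd ℂ) t)) w = (2 * Real.pi : ℂ)⁻¹ *
      ∫ θ in (0 : ℝ)..2 * Real.pi, (starRingEnd ℂ) (circleMap 0 1 θ) /
        ((starRingEnd ℂ) (circleMap 0 1 θ) - w) * φ (circleMap 0 1 θ) := by
  have hc : ∀ θ : ℝ, (starRingEnd ℂ) (circleMap 0 1 θ) = circleMap 0 1 (-θ) := fun θ => by
    simp [circleMap, ← exp_conj]
  simp_rw [cauchyDisc, hc]
  congr 1
  have hp : Function.Periodic (fun θ : ℝ => circleMap 0 1 θ / (circleMap 0 1 θ - w) *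
      φ (circleMap 0 1 (-θ))) (2 * Real.pi) := fun θ => by
    have : circleMap 0 1 (-(θ + 2 * Real.pi)) = circleMap (0 : ℂ) 1 (-θ) := by
      rw [← periodic_circleMap 0 1 (-(θ + 2 * Real.pi))]
      congr 1
      ring
    simp only [periodic_circleMap 0 1 θ, this]
  have := hp.intervalIntegral_add_eq 0 (-(2 * Real.pi))
  rw [zero_add, neg_add_cancel] at this
  have h := intervalIntegral.integral_comp_neg (a := 0) (b := 2 * Real.pi)
    fun θ : ℝ => circleMap 0 1 θ / (circleMap 0 1 θ - w) * φ (circleMap 0 1 (-θ))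
  rw [neg_zero] at h
  simp only [neg_neg] at h
  rw [this, h]

/-- The jump relation on the circle, in terms of radial limits. -/
theorem norm_jump_sub_le (hφ : HolderCircle μ K φ) (hμ0 : 0 < μ) (hμ1 : μ < 1) {ζ : ℂ}
    (hζ : ‖ζ‖ = 1) {r : ℝ} (hr0 : 0 ≤ r) (hr1 : r < 1) :
    ‖cauchyDisc φ (r * ζ) + cauchyDisc (fun t => φ ((starRingEnd ℂ) t)) (r * (starRingEnd ℂ) ζ) -
      cauchyDisc φ 0 - φ ζ‖ ≤ K * (100 / (1 - μ)) * (1 - r) ^ μ := by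
  have hK : 0 ≤ K := (norm_nonneg _).trans (hφ.bound 1 (by simp))
  have hcont := hφ.continuousOn hμ0
  have hc := continuous_comp_circleMap hcont
  have hw : ‖(r : ℂ) * ζ‖ < 1 := by rwa [norm_mul, hζ, mul_one, norm_real, Real.norm_of_nonneg hr0]
  have hw' : ‖(r : ℂ) * (starRingEnd ℂ) ζ‖ < 1 := by
    rwa [norm_mul, RCLike.norm_conj, hζ, mul_one, norm_real, Real.norm_of_nonneg hr0]
  have hw0 : ‖(0 : ℂ)‖ < 1 := by simp
  -- The combination of three integrals reproduces a constant exactly once, so φ(ζ) can be moved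
  -- under the integral signs.
  have e : cauchyDisc φ (r * ζ) + cauchyDisc (fun t => φ ((starRingEnd ℂ) t))
      (r * (starRingEnd ℂ) ζ) - cauchyDisc φ 0 - φ ζ =
      cauchyDisc (fun t => φ t - φ ζ) (r * ζ) + cauchyDisc (fun t => φ ((starRingEnd ℂ) t) - φ ζ)
        (r * (starRingEnd ℂ) ζ) - cauchyDisc (fun t => φ t - φ ζ) 0 := by
    rw [cauchyDisc_sub_const hcont _ hw, cauchyDisc_sub_const (hφ.conj.continuousOn hμ0) _ hw',
      cauchyDisc_sub_const hcont _ hw0]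
    ring
  have hconj0 : ∀ θ, (starRingEnd ℂ) (circleMap 0 1 θ) - r * (starRingEnd ℂ) ζ ≠ 0 := fun θ h => by
    have := circleMap_sub_ne_zero hw θ
    rw [← conj_ofReal r, ← map_mul, ← map_sub] at h
    exact this ((map_eq_zero _).1 h)
  rw [e, cauchyDisc_conj (fun t => φ t - φ ζ), cauchyDisc, cauchyDisc, ← mul_add, ← mul_sub,
    ← intervalIntegral.integral_add, ← intervalIntegral.integral_sub, norm_mul, two_pi_norm]
  rotate_left
  · exact (((continuous_cauchyKernel hw).mul (hc.sub continuous_const)).add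
      (((continuous_conj.comp (continuous_circleMap 0 1)).div
        ((continuous_conj.comp (continuous_circleMap 0 1)).sub continuous_const) hconj0).mul
        (hc.sub continuous_const))).intervalIntegrable _ _
  · exact ((continuous_cauchyKernel hw0).mul (hc.sub continuous_const)).intervalIntegrable _ _
  · exact ((continuous_cauchyKernel hw).mul (hc.sub continuous_const)).intervalIntegrable _ _
  · exact (((continuous_conj.comp (continuous_circleMap 0 1)).div
        ((continuous_conj.comp (continuous_circleMap 0 1)).sub continuous_const) hconj0).mul
        (hc.sub continuous_const)).intervalIntegrable _ _
  have hker := continuous_holderKernel hμ0 hr0 hr1 hζ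
  have hpi := Real.pi_pos
  have h1r : 0 < 1 - r := by linarith
  refine (mul_le_mul_of_nonneg_left (intervalIntegral.norm_integral_le_of_norm_le (by positivity)
      (g := fun θ => 2 * K * (1 - r) * holderKernel μ r ζ θ)
      (Eventually.of_forall fun θ _ => ?_) ((continuous_const.mul hker).intervalIntegrable _ _))
      (by positivity)).trans ?_
  · rw [← add_mul, ← sub_mul, norm_mul]
    have h1 := circleMap_sub_ne_zero hw θ
    have h2 := hconj0 θ
    have h3 := circleMap_sub_ne_zero hw0 θ
    have hz1 : circleMap 0 1 θ * (starRingEnd ℂ) (circleMap 0 1 θ) = 1 := by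
      rw [mul_conj, normSq_eq_norm_sq, norm_circleMap_one]; simp
    have hz2 : ζ * (starRingEnd ℂ) ζ = 1 := by
      rw [mul_conj, normSq_eq_norm_sq, hζ]; simp
    -- The three kernels add up to the Poisson kernel (1 - r²)/|t - rζ|²; its numerator is at most
    -- 2(1 - r), which turns (1 - r)^(μ-1) into (1 - r)^μ.
    have ek : circleMap 0 1 θ / (circleMap 0 1 θ - r * ζ) +
        (starRingEnd ℂ) (circleMap 0 1 θ) /
          ((starRingEnd ℂ) (circleMap 0 1 θ) - r * (starRingEnd ℂ) ζ) -
        circleMap 0 1 θ / (circleMap 0 1 θ - 0) =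
        (1 - r ^ 2) / ((circleMap 0 1 θ - r * ζ) *
          ((starRingEnd ℂ) (circleMap 0 1 θ) - r * (starRingEnd ℂ) ζ)) := by
      rw [sub_zero] at h3 ⊢
      rw [div_self h3]
      field_simp
      linear_combination hz1 - r ^ 2 * hz2
    have hconjn : ‖(starRingEnd ℂ) (circleMap 0 1 θ) - r * (starRingEnd ℂ) ζ‖ =
        ‖circleMap 0 1 θ - r * ζ‖ := by
      rw [← RCLike.norm_conj (circleMap 0 1 θ - r * ζ), map_sub, map_mul, conj_ofReal]
    have h4 := hφ.holder _ (circleMap_mem θ) ζ (by simpa using hζ)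
    have h5 : ‖(1 - r ^ 2 : ℂ)‖ ≤ 2 * (1 - r) := by
      rw [← ofReal_pow, ← ofReal_one, ← ofReal_sub, norm_real, Real.norm_of_nonneg (by nlinarith)]
      nlinarith
    rw [ek, norm_div, norm_mul, hconjn, holderKernel, ← sq, div_mul_eq_mul_div, ← mul_div_assoc]
    refine div_le_div_of_nonneg_right ?_ (sq_nonneg _)
    calc _ ≤ 2 * (1 - r) * (K * ‖circleMap 0 1 θ - ζ‖ ^ μ) := by gcongr
      _ = _ := by ring
  · have hI := integral_holderKernel_le hμ0 hμ1 hr0 hr1 hζ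
    rw [intervalIntegral.integral_const_mul]
    have h1 : 0 < 1 - μ := by linarith
    calc (2 * Real.pi)⁻¹ * _ ≤ 1 / 2 * (2 * K * (1 - r) *
          (100 / (1 - μ) * (1 - r) ^ (μ - 1))) := by
          refine mul_le_mul ?_ (by gcongr) ?_ (by norm_num)
          · rw [one_div]
            exact inv_anti₀ two_pos (by linarith [Real.pi_gt_three])
          · refine mul_nonneg (by positivity) (intervalIntegral.integral_nonneg (by positivity)
              fun θ _ => ?_)
            rw [holderKernel]
            positivity
      _ = _ := by
        rw [Real.rpow_sub_one h1r.ne']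
        field_simp

end Disc

/-! ### Passage between the extended line and the circle -/

theorem norm_add_I (x : ℝ) : ‖(x : ℂ) + I‖ = Real.sqrt (1 + x ^ 2) := by
  rw [eq_comm, Real.sqrt_eq_iff_mul_self_eq (by positivity) (norm_nonneg _), ← sq, normSq_add_I]
  simp [add_comm]

/-- This identifies Hölder continuity on the extended line with Hölder continuity on the circle, the
point at infinity corresponding to t = 1. -/
theorem norm_cayley_sub (x y : ℝ) : ‖cayley x - cayley y‖ = 2 * chord x y := by
  have h1 := add_I_ne_zero (ofReal_mem_closure_upperHalf x)
  have h2 := add_I_ne_zero (ofReal_mem_closure_upperHalf y)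
  have e : cayley x - cayley y = 2 * I * ((x - y : ℝ) : ℂ) / ((x + I) * (y + I)) := by
    rw [cayley, cayley]
    push_cast
    field_simp
    ring
  rw [e, norm_div, norm_mul, norm_mul, norm_mul, norm_I, norm_real, norm_ofNat, norm_add_I,
    norm_add_I, chord, Real.norm_eq_abs]
  ring

theorem chord_nonneg (x y : ℝ) : 0 ≤ chord x y := by
  have := norm_cayley_sub x y
  linarith [norm_nonneg (cayley x - cayley y)]

theorem chord_le_one (x y : ℝ) : chord x y ≤ 1 := by
  have := norm_cayley_sub x y
  have h := norm_sub_le (cayley x) (cayley y)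
  rw [norm_cayley_ofReal, norm_cayley_ofReal] at h
  linarith

theorem chord_neg (x y : ℝ) : chord (-x) (-y) = chord x y := by
  rw [chord, chord, neg_sub_neg, abs_sub_comm, neg_sq, neg_sq]

theorem one_sub_cayley (x : ℝ) : 1 - cayley x = 2 * I / (x + I) := by
  have h1 := add_I_ne_zero (ofReal_mem_closure_upperHalf x)
  rw [cayley]
  field_simp
  ring

theorem cayley_ne_one (x : ℝ) : cayley x ≠ 1 := fun h => by
  have h1 := add_I_ne_zero (ofReal_mem_closure_upperHalf x)
  have := one_sub_cayley x
  rw [h, sub_self, eq_comm, div_eq_zero_iff] at this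
  simp [h1, I_ne_zero] at this

theorem inv_cayley (x : ℝ) : I * (1 + cayley x) / (1 - cayley x) = x := by
  have h1 := add_I_ne_zero (ofReal_mem_closure_upperHalf x)
  rw [one_sub_cayley, cayley]
  field_simp [I_ne_zero]
  ring

theorem exists_cayley_eq {t : ℂ} (ht : ‖t‖ = 1) (h1 : t ≠ 1) : ∃ x : ℝ, cayley x = t := by
  have h1' : 1 - t ≠ 0 := sub_ne_zero.2 h1.symm
  have hc : t * (starRingEnd ℂ) t = 1 := by
    rw [mul_conj, normSq_eq_norm_sq, ht]; simp
  have h2 : 1 - (starRingEnd ℂ) t ≠ 0 := fun h => by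
    rw [sub_eq_zero] at h
    rw [← h, mul_one] at hc
    exact h1 hc
  obtain ⟨x, hx⟩ := conj_eq_iff_real.1 (show (starRingEnd ℂ) (I * (1 + t) / (1 - t)) =
      I * (1 + t) / (1 - t) by
    rw [map_div₀, map_mul, map_add, map_sub, map_one, conj_I, div_eq_div_iff h2 h1']
    linear_combination (2 * I) * hc)
  refine ⟨x, ?_⟩
  rw [cayley, ← hx]
  have h3 : I * (1 + t) / (1 - t) + I = 2 * I / (1 - t) := by field_simp; ring
  have h4 : I * (1 + t) / (1 - t) - I = 2 * I * t / (1 - t) := by field_simp; ring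
  rw [h3, h4]
  field_simp [I_ne_zero]

theorem tendsto_cayley_atTop : Tendsto (fun x : ℝ => cayley x) atTop (𝓝 1) := by
  rw [tendsto_iff_norm_sub_tendsto_zero]
  refine squeeze_zero' (g := fun x : ℝ => 2 / x) (Eventually.of_forall fun _ => norm_nonneg _) ?_
    (tendsto_const_nhds.div_atTop tendsto_id)
  filter_upwards [eventually_gt_atTop 0] with x hx
  rw [norm_sub_rev, one_sub_cayley, norm_div, norm_mul, norm_I, norm_ofNat, mul_one, norm_add_I]
  gcongr
  exact Real.le_sqrt_of_sq_le (by linarith)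

section Transfer

variable {μ K : ℝ} {m : ℝ → ℂ}

theorem HolderBound.nonneg {f : ℝ → ℂ} (h : HolderBound μ K f) : 0 ≤ K :=
  (norm_nonneg _).trans (h.1 0)

theorem HolderBound.norm_sub_le_cayley (hm : HolderBound μ K m) (hμ0 : 0 < μ) (x y : ℝ) :
    ‖m x - m y‖ ≤ K * ‖cayley x - cayley y‖ ^ μ := by
  refine (hm.2 x y).trans (mul_le_mul_of_nonneg_left (Real.rpow_le_rpow (chord_nonneg x y) ?_ hμ0.le)
    hm.nonneg)
  rw [norm_cayley_sub]
  linarith [chord_nonneg x y]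

/-- The points `cayley x` converge to 1, so the Hölder condition makes m Cauchy at infinity. The
limit serves as the value at t = 1 of the transplanted function. -/
theorem HolderBound.exists_limit (hm : HolderBound μ K m) (hμ0 : 0 < μ) :
    ∃ L, Tendsto m atTop (𝓝 L) := by
  refine cauchy_map_iff_exists_tendsto.1 (cauchy_map_iff'.2 ?_)
  rw [tendsto_uniformity_iff_dist_tendsto_zero]
  refine squeeze_zero (g := fun p : ℝ × ℝ => K * ‖cayley p.1 - cayley p.2‖ ^ μ)
    (fun _ => dist_nonneg) (fun p => by
      rw [dist_eq_norm]; exact hm.norm_sub_le_cayley hμ0 p.1 p.2) ?_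
  have h := (((tendsto_cayley_atTop.comp tendsto_fst).sub (tendsto_cayley_atTop.comp
    tendsto_snd)).norm.rpow_const (p := μ) (Or.inr hμ0.le)).const_mul K
  simpa [hμ0.ne', Function.comp_def] using h

theorem HolderBound.exists_holderCircle (hm : HolderBound μ K m) (hμ0 : 0 < μ) :
    ∃ φ : ℂ → ℂ, HolderCircle μ K φ ∧ ∀ x : ℝ, φ (cayley x) = m x := by
  obtain ⟨L, hL⟩ := hm.exists_limit hμ0
  have hLn : ‖L‖ ≤ K := le_of_tendsto hL.norm (Eventually.of_forall hm.1)
  have hLx : ∀ x : ℝ, ‖m x - L‖ ≤ K * ‖cayley x - 1‖ ^ μ := fun x =>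
    le_of_tendsto_of_tendsto' (hL.const_sub (m x)).norm
      (((tendsto_cayley_atTop.const_sub (cayley x)).norm.rpow_const (Or.inr hμ0.le)).const_mul K)
      fun y => hm.norm_sub_le_cayley hμ0 x y
  refine ⟨fun t => if t = 1 then L else m (I * (1 + t) / (1 - t)).re, ⟨fun t _ => ?_,
    fun s hs t ht => ?_⟩, fun x => ?_⟩
  · split_ifs
    exacts [hLn, hm.1 _]
  · rw [mem_sphere_zero_iff_norm] at hs ht
    by_cases hs1 : s = 1 <;> by_cases ht1 : t = 1
    · simp [hs1, ht1, hμ0.ne']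
    · obtain ⟨x, rfl⟩ := exists_cayley_eq ht ht1
      rw [if_pos hs1, if_neg ht1, inv_cayley, ofReal_re, hs1, norm_sub_rev, norm_sub_rev 1]
      exact hLx x
    · obtain ⟨x, rfl⟩ := exists_cayley_eq hs hs1
      rw [if_pos ht1, if_neg hs1, inv_cayley, ofReal_re, ht1]
      exact hLx x
    · obtain ⟨x, rfl⟩ := exists_cayley_eq hs hs1
      obtain ⟨y, rfl⟩ := exists_cayley_eq ht ht1
      rw [if_neg ht1, if_neg hs1, inv_cayley, inv_cayley, ofReal_re, ofReal_re]
      exact hm.norm_sub_le_cayley hμ0 x y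
  · simp only [if_neg (cayley_ne_one x), inv_cayley, ofReal_re]

end Transfer

/-! ### Splitting a Hölder function on the line -/

/-- `f` is analytic in `U`, continuous and bounded by `K` in the closure of `U`, and its values on
the real line have Hölder norm at most `K`. -/
structure HolderAnalytic (μ K : ℝ) (U : Set ℂ) (f : ℂ → ℂ) : Prop extends
    BddAnalytic K U f where
  holder : HolderBound μ K fun x : ℝ => f x

theorem HolderAnalytic.reflect_upper {μ K : ℝ} {f : ℂ → ℂ} (hf : HolderAnalytic μ K upperHalf f) :
    HolderAnalytic μ K lowerHalf fun z => f (-z) :=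
  ⟨hf.toBddAnalytic.reflect_upper, fun x => by simpa using hf.holder.1 (-x), fun x y => by
    have := hf.holder.2 (-x) (-y)
    rw [chord_neg] at this
    push_cast at this
    exact this⟩

theorem HolderAnalytic.comp_cayley {μ K A B : ℝ} {G : ℂ → ℂ} (hμ0 : 0 < μ) (hμ1 : μ < 1)
    (hG : DiffContOnCl ℂ G (ball 0 1)) (h0 : ‖G 0‖ ≤ B)
    (hd : ∀ v ∈ closedBall (0 : ℂ) 1, ∀ w ∈ closedBall (0 : ℂ) 1, ‖G v - G w‖ ≤ A * ‖v - w‖ ^ μ)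
    (hA : 0 ≤ A) (hK : 2 * A + B ≤ K) : HolderAnalytic μ K upperHalf fun z => G (cayley z) := by
  have hB : 0 ≤ B := (norm_nonneg _).trans h0
  have hmem : ∀ z ∈ closure upperHalf, cayley z ∈ closedBall (0 : ℂ) 1 := fun z hz => by
    simpa using norm_cayley_le hz
  have hb : BddAnalytic K upperHalf fun z => G (cayley z) := by
    refine ⟨hG.comp bddAnalytic_cayley.diff fun z hz => by simpa using norm_cayley_lt hz,
      fun z hz => ?_⟩
    have h1 := hd _ (hmem z hz) 0 (by simp)
    rw [sub_zero] at h1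
    have h2 : ‖cayley z‖ ^ μ ≤ 1 := Real.rpow_le_one (norm_nonneg _) (norm_cayley_le hz) hμ0.le
    have h3 : ‖G (cayley z)‖ ≤ ‖G (cayley z) - G 0‖ + ‖G 0‖ := by
      simpa using norm_add_le (G (cayley z) - G 0) (G 0)
    nlinarith
  refine ⟨hb, fun x => hb.bound x (ofReal_mem_closure_upperHalf x), fun x y => ?_⟩
  refine (hd _ (hmem x (ofReal_mem_closure_upperHalf x)) _
    (hmem y (ofReal_mem_closure_upperHalf y))).trans ?_
  rw [norm_cayley_sub, Real.mul_rpow zero_le_two (chord_nonneg x y), ← mul_assoc]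
  have : (2 : ℝ) ^ μ ≤ 2 :=
    (Real.rpow_le_rpow_of_exponent_le one_le_two hμ1.le).trans_eq (Real.rpow_one 2)
  have := Real.rpow_nonneg (chord_nonneg x y) μ
  gcongr
  nlinarith

theorem HolderAnalytic.sub_const {μ K B L : ℝ} {U : Set ℂ} {f : ℂ → ℂ}
    (hf : HolderAnalytic μ K U f) {c : ℂ} (hc : ‖c‖ ≤ B) (hL : K + B ≤ L) :
    HolderAnalytic μ L U fun z => f z - c := by
  have hB : 0 ≤ B := (norm_nonneg _).trans hc
  refine ⟨(hf.toBddAnalytic.sub (BddAnalytic.const c)).mono (by linarith), fun x => ?_,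
    fun x y => ?_⟩
  · exact (norm_sub_le _ _).trans (by linarith [hf.holder.1 x])
  · rw [sub_sub_sub_cancel_right]
    refine (hf.holder.2 x y).trans (mul_le_mul_of_nonneg_right (by linarith)
      (Real.rpow_nonneg (chord_nonneg x y) μ))

/-- Every Hölder function on the extended line is the sum of boundary values of functions analytic
in the two half-planes, with control of the norms. -/
theorem exists_jump {μ : ℝ} (hμ0 : 0 < μ) (hμ1 : μ < 1) :
    ∃ D, 0 ≤ D ∧ ∀ (K : ℝ) (m : ℝ → ℂ), HolderBound μ K m →
      ∃ P Q : ℂ → ℂ, HolderAnalytic μ (D * K) upperHalf P ∧ HolderAnalytic μ (D * K) lowerHalf Q ∧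
        ∀ x : ℝ, m x = P x + Q x := by
  have hc := privalovConst_pos hμ0 hμ1
  refine ⟨2 * privalovConst μ + 2, by positivity, fun K m hm => ?_⟩
  have hK := hm.nonneg
  obtain ⟨φ, hφ, hφm⟩ := hm.exists_holderCircle hμ0
  obtain ⟨G, hG, hGF, hGd⟩ := exists_cauchyDisc_extension hφ hμ0 hμ1
  obtain ⟨H, hH, hHF, hHd⟩ := exists_cauchyDisc_extension hφ.conj hμ0 hμ1
  have h0 : (0 : ℂ) ∈ ball (0 : ℂ) 1 := by simp
  have hG0 : ‖G 0‖ ≤ K := by rw [hGF h0]; exact norm_cauchyDisc_zero_le hφ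
  have hH0 : ‖H 0‖ ≤ K := by rw [hHF h0]; exact norm_cauchyDisc_zero_le hφ.conj
  have hA : 0 ≤ K * privalovConst μ := by positivity
  have hPG := HolderAnalytic.comp_cayley hμ0 hμ1 hG hG0 hGd hA
    (K := (2 * privalovConst μ + 2) * K) (by linarith)
  have hPH := HolderAnalytic.comp_cayley hμ0 hμ1 hH hH0 hHd hA
    (K := (2 * privalovConst μ + 1) * K) (by linarith)
  -- Q is H(`cayley (-z)`) - G(0): on the line `cayley (-x)` is the conjugate of `cayley x`, and
  -- G(0) is the mean of φ subtracted in the jump relation. It accounts for the last unit in the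
  -- constant 2c + 2.
  refine ⟨_, _, hPG, hPH.reflect_upper.sub_const hG0 (by linarith), fun x => ?_⟩
  have hζ := norm_cayley_ofReal x
  set ζ := cayley x with hζdef
  have hconj : cayley (-x) = (starRingEnd ℂ) ζ := by
    rw [cayley_neg, ← hζdef, inv_def, normSq_eq_norm_sq, hζ]
    simp
  rw [hconj, ← hφm]
  have hr : ∀ᶠ r : ℝ in 𝓝[<] 1, r ∈ Ioo 0 1 := Ioo_mem_nhdsLT one_pos
  have hball : ∀ r ∈ Ioo (0 : ℝ) 1, ∀ v : ℂ, ‖v‖ = 1 → (r : ℂ) * v ∈ ball (0 : ℂ) 1 :=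
    fun r hr v hv => by
      rw [mem_ball_zero_iff, norm_mul, norm_real, Real.norm_of_nonneg hr.1.le, hv, mul_one]
      exact hr.2
  have hlim : ∀ {G : ℂ → ℂ}, DiffContOnCl ℂ G (ball 0 1) → ∀ v : ℂ, ‖v‖ = 1 →
      Tendsto (fun r : ℝ => G (r * v)) (𝓝[<] 1) (𝓝 (G v)) := fun {G} hG v hv => by
    have hc : Continuous fun r : ℝ => (r : ℂ) * v := by fun_prop
    have h1 : Tendsto (fun r : ℝ => (r : ℂ) * v) (𝓝[<] 1) (𝓝[closedBall 0 1] v) :=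
      tendsto_nhdsWithin_iff.2 ⟨by simpa using (hc.tendsto 1).mono_left nhdsWithin_le_nhds,
        hr.mono fun r hr => ball_subset_closedBall (hball r hr v hv)⟩
    have h2 := hG.continuousOn
    rw [closure_ball _ one_ne_zero] at h2
    exact (h2 v (by simp [hv])).tendsto.comp h1
  have hζ' : ‖(starRingEnd ℂ) ζ‖ = 1 := by rw [RCLike.norm_conj, hζ]
  have hL := ((((hlim hG ζ hζ).add (hlim hH _ hζ')).sub_const (G 0)).sub_const (φ ζ)).norm
  have hz : Tendsto (fun r : ℝ => K * (100 / (1 - μ)) * (1 - r) ^ μ) (𝓝[<] 1) (𝓝 0) := by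
    have hc : Continuous fun r : ℝ => K * (100 / (1 - μ)) * (1 - r) ^ μ :=
      continuous_const.mul ((continuous_const.sub continuous_id).rpow_const
        fun _ => Or.inr hμ0.le)
    simpa [hμ0.ne'] using (hc.tendsto 1).mono_left nhdsWithin_le_nhds
  have hle := le_of_tendsto_of_tendsto hL hz (hr.mono fun r hr => by
    dsimp only
    rw [hGF (hball r hr ζ hζ), hHF (hball r hr _ hζ'), hGF h0]
    exact norm_jump_sub_le hφ hμ0 hμ1 hζ hr.1.le hr.2)
  have := norm_le_zero_iff.1 hle
  linear_combination -this

/-! ### Algebra of Hölder bounds -/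

namespace HolderBound

variable {μ K L : ℝ} {f g : ℝ → ℂ}

theorem mono (hf : HolderBound μ K f) (h : K ≤ L) : HolderBound μ L f :=
  ⟨fun x => (hf.1 x).trans h, fun x y => (hf.2 x y).trans
    (mul_le_mul_of_nonneg_right h (Real.rpow_nonneg (chord_nonneg x y) μ))⟩

theorem add (hf : HolderBound μ K f) (hg : HolderBound μ L g) :
    HolderBound μ (K + L) fun x => f x + g x :=
  ⟨fun x => (norm_add_le _ _).trans (add_le_add (hf.1 x) (hg.1 x)), fun x y => by
    rw [add_sub_add_comm, add_mul]
    exact (norm_add_le _ _).trans (add_le_add (hf.2 x y) (hg.2 x y))⟩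

theorem const (c : ℂ) : HolderBound μ ‖c‖ fun _ => c :=
  ⟨fun _ => le_rfl, fun x y => by
    rw [sub_self, norm_zero]
    exact mul_nonneg (norm_nonneg _) (Real.rpow_nonneg (chord_nonneg x y) μ)⟩

theorem const_mul (hf : HolderBound μ K f) (c : ℂ) : HolderBound μ (‖c‖ * K) fun x => c * f x :=
  ⟨fun x => by rw [norm_mul]; exact mul_le_mul_of_nonneg_left (hf.1 x) (norm_nonneg _), fun x y => by
    rw [← mul_sub, norm_mul, mul_assoc]
    exact mul_le_mul_of_nonneg_left (hf.2 x y) (norm_nonneg _)⟩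

theorem mul (hf : HolderBound μ K f) (hg : HolderBound μ L g) :
    HolderBound μ (2 * K * L) fun x => f x * g x := by
  have hK := hf.nonneg
  have hL := hg.nonneg
  refine ⟨fun x => ?_, fun x y => ?_⟩
  · rw [norm_mul]
    have := mul_le_mul (hf.1 x) (hg.1 x) (norm_nonneg _) hK
    have := mul_nonneg hK hL
    linarith
  · have e : f x * g x - f y * g y = f x * (g x - g y) + (f x - f y) * g y := by ring
    rw [e]
    refine (norm_add_le _ _).trans ?_
    rw [norm_mul, norm_mul]
    have h1 := mul_le_mul (hf.1 x) (hg.2 x y) (norm_nonneg _) hK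
    have h2 := mul_le_mul (hf.2 x y) (hg.1 y) (norm_nonneg _)
      (mul_nonneg hK (Real.rpow_nonneg (chord_nonneg x y) μ))
    linarith

theorem sum {ι : Type*} (s : Finset ι) {f : ι → ℝ → ℂ} {K : ι → ℝ}
    (hf : ∀ i ∈ s, HolderBound μ (K i) (f i)) :
    HolderBound μ (∑ i ∈ s, K i) fun x => ∑ i ∈ s, f i x := by
  classical
  induction s using Finset.induction_on with
  | empty => simpa using const (μ := μ) 0
  | insert a s ha ih =>
    simp only [Finset.sum_insert ha]
    exact (hf a (Finset.mem_insert_self a s)).add (ih fun i hi => hf i (Finset.mem_insert_of_mem hi))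

theorem inv (hf : HolderBound μ K f) {δ : ℝ} (hδ : 0 < δ) (h : ∀ x, δ ≤ ‖f x‖) :
    HolderBound μ (δ⁻¹ + (δ ^ 2)⁻¹ * K) fun x => (f x)⁻¹ := by
  have hK := hf.nonneg
  have h0 : ∀ x, f x ≠ 0 := fun x => norm_pos_iff.1 (hδ.trans_le (h x))
  have hinv : ∀ x, ‖(f x)⁻¹‖ ≤ δ⁻¹ := fun x => by
    rw [norm_inv]
    exact inv_anti₀ hδ (h x)
  refine ⟨fun x => (hinv x).trans (le_add_of_nonneg_right (by positivity)), fun x y => ?_⟩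
  have e : (f x)⁻¹ - (f y)⁻¹ = (f x)⁻¹ * (f y)⁻¹ * (f y - f x) := by
    have := h0 x
    have := h0 y
    field_simp
  have hp := Real.rpow_nonneg (chord_nonneg x y) μ
  rw [e, norm_mul, norm_mul, norm_sub_rev]
  calc _ ≤ δ⁻¹ * δ⁻¹ * (K * chord x y ^ μ) := by
        gcongr
        exacts [hinv x, hinv y, hf.2 x y]
    _ = (0 + (δ ^ 2)⁻¹ * K) * chord x y ^ μ := by rw [sq, mul_inv]; ring
    _ ≤ _ := by gcongr; positivity

end HolderBound

theorem holderBound_cayley {μ : ℝ} (hμ0 : 0 < μ) (hμ1 : μ < 1) :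
    HolderBound μ 2 fun x => cayley x :=
  ⟨fun x => by rw [norm_cayley_ofReal]; norm_num, fun x y => by
    rw [norm_cayley_sub]
    gcongr
    exact (Real.rpow_one (chord x y)).ge.trans
      (Real.rpow_le_rpow_of_exponent_ge' (chord_nonneg x y) (chord_le_one x y) hμ0.le hμ1.le)⟩

namespace HolderAnalytic

variable {μ K L : ℝ} {U : Set ℂ} {f g : ℂ → ℂ}

theorem mono (hf : HolderAnalytic μ K U f) (h : K ≤ L) : HolderAnalytic μ L U f :=
  ⟨hf.toBddAnalytic.mono h, hf.holder.mono h⟩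

theorem add (hf : HolderAnalytic μ K U f) (hg : HolderAnalytic μ L U g) :
    HolderAnalytic μ (K + L) U fun z => f z + g z :=
  ⟨hf.toBddAnalytic.add hg.toBddAnalytic, hf.holder.add hg.holder⟩

theorem const (c : ℂ) : HolderAnalytic μ ‖c‖ U fun _ => c :=
  ⟨BddAnalytic.const c, HolderBound.const c⟩

theorem mul (hf : HolderAnalytic μ K U f) (hg : HolderAnalytic μ L U g) :
    HolderAnalytic μ (2 * K * L) U fun z => f z * g z :=
  ⟨(hf.toBddAnalytic.mul hg.toBddAnalytic).mono
    (by nlinarith [mul_nonneg hf.holder.nonneg hg.holder.nonneg]), hf.holder.mul hg.holder⟩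

theorem inv (hU : ∀ x : ℝ, (x : ℂ) ∈ closure U) (hf : HolderAnalytic μ K U f) {δ : ℝ} (hδ : 0 < δ)
    (h : ∀ z ∈ closure U, δ ≤ ‖f z‖) :
    HolderAnalytic μ (δ⁻¹ + (δ ^ 2)⁻¹ * K) U fun z => (f z)⁻¹ := by
  have hK := hf.holder.nonneg
  refine ⟨⟨hf.diff.inv fun z hz => norm_pos_iff.1 (hδ.trans_le (h z hz)), fun z hz => ?_⟩,
    hf.holder.inv hδ fun x => h x (hU x)⟩
  rw [norm_inv]
  exact (inv_anti₀ hδ (h z hz)).trans (le_add_of_nonneg_right (by positivity))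

end HolderAnalytic

theorem holderAnalytic_cayley {μ : ℝ} (hμ0 : 0 < μ) (hμ1 : μ < 1) :
    HolderAnalytic μ 2 upperHalf cayley :=
  ⟨bddAnalytic_cayley.mono one_le_two, holderBound_cayley hμ0 hμ1⟩

theorem holderAnalytic_inv_cayley {μ : ℝ} (hμ0 : 0 < μ) (hμ1 : μ < 1) :
    HolderAnalytic μ 2 lowerHalf fun z => (cayley z)⁻¹ := by
  simpa only [cayley_neg] using (holderAnalytic_cayley hμ0 hμ1).reflect_upper

/-! ### Uniformly bounded families and inversion near the identity -/

/-- The family `f ε`, `ε ∈ S`, is analytic in `U` with uniformly bounded Hölder norms. -/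
def UnifHolder (μ : ℝ) (U : Set ℂ) (S : Set ℝ) (f : ℝ → ℂ → ℂ) : Prop :=
  ∃ K, ∀ ε ∈ S, HolderAnalytic μ K U (f ε)

namespace UnifHolder

variable {μ : ℝ} {U : Set ℂ} {S T : Set ℝ} {f g : ℝ → ℂ → ℂ}

theorem mono (hf : UnifHolder μ U S f) (h : T ⊆ S) : UnifHolder μ U T f :=
  hf.imp fun _ hK ε hε => hK ε (h hε)

theorem of_const {K : ℝ} {f : ℂ → ℂ} (hf : HolderAnalytic μ K U f) :
    UnifHolder μ U S fun _ => f :=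
  ⟨K, fun _ _ => hf⟩

theorem const (c : ℂ) : UnifHolder μ U S fun _ _ => c := of_const (HolderAnalytic.const c)

theorem add (hf : UnifHolder μ U S f) (hg : UnifHolder μ U S g) :
    UnifHolder μ U S fun ε z => f ε z + g ε z := by
  obtain ⟨K, hK⟩ := hf
  obtain ⟨L, hL⟩ := hg
  exact ⟨_, fun ε hε => (hK ε hε).add (hL ε hε)⟩

theorem mul (hf : UnifHolder μ U S f) (hg : UnifHolder μ U S g) :
    UnifHolder μ U S fun ε z => f ε z * g ε z := by
  obtain ⟨K, hK⟩ := hf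
  obtain ⟨L, hL⟩ := hg
  exact ⟨_, fun ε hε => (hK ε hε).mul (hL ε hε)⟩

theorem sum {ι : Type*} (s : Finset ι) {f : ι → ℝ → ℂ → ℂ}
    (hf : ∀ i ∈ s, UnifHolder μ U S (f i)) : UnifHolder μ U S fun ε z => ∑ i ∈ s, f i ε z := by
  classical
  induction s using Finset.induction_on with
  | empty => simpa using const 0
  | insert a s ha ih =>
    simp only [Finset.sum_insert ha]
    exact (hf a (Finset.mem_insert_self a s)).add (ih fun i hi => hf i (Finset.mem_insert_of_mem hi))

theorem prod {ι : Type*} (s : Finset ι) {f : ι → ℝ → ℂ → ℂ}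
    (hf : ∀ i ∈ s, UnifHolder μ U S (f i)) : UnifHolder μ U S fun ε z => ∏ i ∈ s, f i ε z := by
  classical
  induction s using Finset.induction_on with
  | empty => simpa using const 1
  | insert a s ha ih =>
    simp only [Finset.prod_insert ha]
    exact (hf a (Finset.mem_insert_self a s)).mul (ih fun i hi => hf i (Finset.mem_insert_of_mem hi))

theorem pow (hf : UnifHolder μ U S f) (k : ℕ) : UnifHolder μ U S fun ε z => f ε z ^ k := by
  simpa using prod (Finset.range k) (f := fun _ => f) fun _ _ => hf

end UnifHolder

/-- The entries of the family of matrix functions `F ε`, `ε ∈ S`, are analytic in `U` with uniformly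
bounded Hölder norms. -/
def UnifMat {n : ℕ} (μ : ℝ) (U : Set ℂ) (S : Set ℝ) (F : ℝ → ℂ → Matrix (Fin n) (Fin n) ℂ) : Prop :=
  ∀ i j, UnifHolder μ U S fun ε z => F ε z i j

namespace UnifMat

variable {n : ℕ} {μ : ℝ} {U : Set ℂ} {S T : Set ℝ} {F H : ℝ → ℂ → Matrix (Fin n) (Fin n) ℂ}

theorem mono (hF : UnifMat μ U S F) (h : T ⊆ S) : UnifMat μ U T F := fun i j => (hF i j).mono h

theorem exists_bound (hF : UnifMat μ U S F) :
    ∃ K, 0 ≤ K ∧ ∀ ε ∈ S, ∀ i j, HolderAnalytic μ K U fun z => F ε z i j := by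
  choose K hK using hF
  refine ⟨∑ i, ∑ j, |K i j|, Finset.sum_nonneg fun i _ => Finset.sum_nonneg fun j _ => abs_nonneg _,
    fun ε hε i j => (hK i j ε hε).mono ?_⟩
  calc K i j ≤ |K i j| := le_abs_self _
    _ ≤ ∑ j, |K i j| := Finset.single_le_sum (f := fun j => |K i j|) (fun _ _ => abs_nonneg _)
      (Finset.mem_univ j)
    _ ≤ _ := Finset.single_le_sum (f := fun i => ∑ j, |K i j|)
      (fun _ _ => Finset.sum_nonneg fun _ _ => abs_nonneg _) (Finset.mem_univ i)

theorem mul (hF : UnifMat μ U S F) (hH : UnifMat μ U S H) :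
    UnifMat μ U S fun ε z => F ε z * H ε z := fun i j => by
  simp only [Matrix.mul_apply]
  exact UnifHolder.sum _ fun k _ => (hF i k).mul (hH k j)

theorem det (hF : UnifMat μ U S F) : UnifHolder μ U S fun ε z => (F ε z).det := by
  simp only [Matrix.det_apply, Units.smul_def, zsmul_eq_mul]
  exact UnifHolder.sum _ fun σ _ => (UnifHolder.const _).mul (UnifHolder.prod _ fun i _ => hF _ _)

theorem adjugate (hF : UnifMat μ U S F) : UnifMat μ U S fun ε z => (F ε z).adjugate := fun i j => by
  simp only [Matrix.adjugate_apply]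
  refine det (F := fun ε z => (F ε z).updateRow j (Pi.single i 1)) fun k l => ?_
  simp only [Matrix.updateRow_apply]
  split_ifs
  · exact UnifHolder.const _
  · exact hF k l

/-- Cramer's rule: adjugate and determinant are polynomials in the entries, so a lower bound on the
determinant suffices. -/
theorem inv (hU : ∀ x : ℝ, (x : ℂ) ∈ closure U) (hF : UnifMat μ U S F) {δ : ℝ} (hδ : 0 < δ)
    (h : ∀ ε ∈ S, ∀ z ∈ closure U, δ ≤ ‖(F ε z).det‖) :
    UnifMat μ U S fun ε z => (F ε z)⁻¹ := fun i j => by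
  obtain ⟨K, hK⟩ := hF.det
  have hd : UnifHolder μ U S fun ε z => ((F ε z).det)⁻¹ :=
    ⟨_, fun ε hε => (hK ε hε).inv hU hδ (h ε hε)⟩
  simp only [Matrix.inv_def, Matrix.smul_apply, Ring.inverse_eq_inv', smul_eq_mul]
  exact hd.mul (hF.adjugate i j)

theorem of_const {K : ℝ} {F : ℂ → Matrix (Fin n) (Fin n) ℂ}
    (hF : ∀ i j, HolderAnalytic μ K U fun z => F z i j) : UnifMat μ U S fun _ => F :=
  fun i j => UnifHolder.of_const (hF i j)

theorem diagonal {d : Fin n → ℂ → ℂ} (hd : ∀ j, UnifHolder μ U S fun _ => d j) :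
    UnifMat μ U S fun _ z => Matrix.diagonal fun j => d j z := fun i j => by
  simp only [Matrix.diagonal_apply]
  split_ifs
  · exact hd i
  · exact UnifHolder.const 0

end UnifMat

theorem exists_half_le_norm_det (n : ℕ) : ∃ δ > 0, ∀ M : Matrix (Fin n) (Fin n) ℂ,
    (∀ i j, ‖M i j‖ ≤ δ) → 1 / 2 ≤ ‖(1 + M).det‖ := by
  have hc : Continuous fun M : Fin n → Fin n → ℂ => ‖(1 + Matrix.of M).det‖ :=
    (Continuous.matrix_det (continuous_const.add continuous_id)).norm
  have h0 : (1 / 2 : ℝ) < ‖((1 : Matrix (Fin n) (Fin n) ℂ) + Matrix.of (0 : Fin n → Fin n → ℂ)).det‖ := by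
    rw [show Matrix.of (0 : Fin n → Fin n → ℂ) = 0 from rfl, add_zero, Matrix.det_one, norm_one]
    norm_num
  obtain ⟨δ, hδ, h⟩ := Metric.eventually_nhds_iff.1 (hc.continuousAt.eventually (lt_mem_nhds h0))
  refine ⟨δ / 2, half_pos hδ, fun M hM => (h (y := fun i j => M i j) ?_).le⟩
  rw [dist_zero_right]
  refine lt_of_le_of_lt ?_ (half_lt_self hδ)
  exact (pi_norm_le_iff_of_nonneg (half_pos hδ).le).2 fun i =>
    (pi_norm_le_iff_of_nonneg (half_pos hδ).le).2 fun j => hM i j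

/-- Small perturbations of the identity are invertible, with uniformly bounded inverses. -/
theorem UnifMat.one_add_smul {n : ℕ} {μ : ℝ} {U : Set ℂ} (hU : ∀ x : ℝ, (x : ℂ) ∈ closure U) {e : ℝ}
    {X : ℝ → ℂ → Matrix (Fin n) (Fin n) ℂ} (hX : UnifMat μ U (Ico 0 e) X) :
    ∃ δ > 0, ∀ δ' ≤ δ, δ' ≤ e →
      UnifMat μ U (Ico 0 δ') (fun ε z => 1 + (ε : ℂ) • X ε z) ∧
      UnifMat μ U (Ico 0 δ') (fun ε z => (1 + (ε : ℂ) • X ε z)⁻¹) ∧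
      ∀ ε ∈ Ico 0 δ', ∀ z ∈ closure U, IsUnit (1 + (ε : ℂ) • X ε z) := by
  obtain ⟨K, hK0, hK⟩ := hX.exists_bound
  obtain ⟨δ, hδ, hdet⟩ := exists_half_le_norm_det n
  -- The entries of εX are then at most δ, which keeps the determinant at least 1/2 in modulus.
  -- Allowing every smaller δ' lets both half-planes use one interval.
  refine ⟨δ / (K + 1), by positivity, fun δ' hδ' he => ?_⟩
  have hsub : Ico 0 δ' ⊆ Ico 0 e := Ico_subset_Ico_right he
  have hd : ∀ ε ∈ Ico 0 δ', ∀ z ∈ closure U, 1 / 2 ≤ ‖(1 + (ε : ℂ) • X ε z).det‖ :=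
    fun ε hε z hz => hdet _ fun i j => by
      rw [Matrix.smul_apply, smul_eq_mul, norm_mul, norm_real, Real.norm_of_nonneg hε.1]
      have h1 : ε ≤ δ / (K + 1) := hε.2.le.trans hδ'
      rw [le_div_iff₀ (by positivity)] at h1
      have h2 := (hK ε (hsub hε) i j).bound z hz
      nlinarith [hε.1]
  have hF : UnifMat μ U (Ico 0 δ') (fun ε z => 1 + (ε : ℂ) • X ε z) := fun i j => by
    simp only [Matrix.add_apply, Matrix.smul_apply, smul_eq_mul]
    refine (UnifHolder.const _).add (UnifHolder.mul ⟨δ', fun ε hε => ?_⟩ ((hX i j).mono hsub))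
    refine (HolderAnalytic.const (ε : ℂ)).mono ?_
    rw [norm_real, Real.norm_of_nonneg hε.1]
    exact hε.2.le
  refine ⟨hF, hF.inv hU one_half_pos hd, fun ε hε z hz => ?_⟩
  rw [Matrix.isUnit_iff_isUnit_det, isUnit_iff_ne_zero, ← norm_pos_iff]
  linarith [hd ε hε z hz]

theorem MatHolderBound.mul {n : ℕ} {μ K L : ℝ} {F H : ℝ → Matrix (Fin n) (Fin n) ℂ}
    (hF : MatHolderBound μ K F) (hH : MatHolderBound μ L H) :
    MatHolderBound μ (n * (2 * K * L)) fun x => F x * H x := fun i j => by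
  simp only [Matrix.mul_apply]
  have := HolderBound.sum Finset.univ (f := fun k x => F x i k * H x k j)
    fun k _ => (hF i k).mul (hH k j)
  simpa using this

theorem IsBoundedFactor.unifMat {n : ℕ} {μ K : ℝ} {U : Set ℂ} {S : Set ℝ}
    {F : ℂ → Matrix (Fin n) (Fin n) ℂ} (h : IsBoundedFactor μ K U F) : UnifMat μ U S fun _ => F :=
  UnifMat.of_const fun i j => ⟨⟨h.analytic i j, fun z hz => h.bounded z hz i j⟩, h.holder i j⟩

theorem IsBoundedFactor.unifMat_inv {n : ℕ} {μ K : ℝ} {U : Set ℂ} {S : Set ℝ}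
    {F : ℂ → Matrix (Fin n) (Fin n) ℂ} (h : IsBoundedFactor μ K U F) :
    UnifMat μ U S fun _ z => (F z)⁻¹ :=
  UnifMat.of_const fun i j =>
    ⟨⟨h.analytic_inv i j, fun z hz => h.bounded_inv z hz i j⟩, h.holder_inv i j⟩

/-- Stated for every L ≥ K so that the minus and plus factors can share one constant. -/
theorem exists_isBoundedFactor {n : ℕ} {μ : ℝ} {U : Set ℂ} {S : Set ℝ}
    {F : ℝ → ℂ → Matrix (Fin n) (Fin n) ℂ} (hF : UnifMat μ U S F)
    (hF' : UnifMat μ U S fun ε z => (F ε z)⁻¹) (hu : ∀ ε ∈ S, ∀ z ∈ closure U, IsUnit (F ε z)) :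
    ∃ K, ∀ L, K ≤ L → ∀ ε ∈ S, IsBoundedFactor μ L U (F ε) := by
  obtain ⟨K, hK0, hK⟩ := hF.exists_bound
  obtain ⟨K', hK'0, hK'⟩ := hF'.exists_bound
  refine ⟨K + K', fun L hL ε hε => ?_⟩
  have h1 := fun i j => (hK ε hε i j).mono (L := L) (by linarith)
  have h2 := fun i j => (hK' ε hε i j).mono (L := L) (by linarith)
  exact ⟨fun i j => (h1 i j).diff, hu ε hε, fun i j => (h2 i j).diff,
    fun z hz i j => (h1 i j).bound z hz, fun z hz i j => (h2 i j).bound z hz,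
    fun i j => (h1 i j).holder, fun i j => (h2 i j).holder⟩

/-! ### The scalar jump problem with zeros at i and -i -/

section Scalar

variable {μ K L : ℝ} {m : ℝ → ℂ} {a b : ℂ → ℂ} {p q : ℕ}

theorem cayley_I : cayley I = 0 := by simp [cayley]

theorem inv_cayley_neg_I : (cayley (-I))⁻¹ = 0 := by simp [cayley_neg, cayley_I]

theorem I_mem_upperHalf : I ∈ upperHalf := by simp [upperHalf]

theorem neg_I_mem_lowerHalf : -I ∈ lowerHalf := by simp [lowerHalf]

theorem BddAnalytic.cayley_pow_mul (hb : BddAnalytic K upperHalf b) (p : ℕ) :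
    ∃ K', BddAnalytic K' upperHalf fun z => cayley z ^ p * b z :=
  ⟨_, (bddAnalytic_cayley.pow p).mul hb⟩

theorem bddAnalytic_inv_cayley : BddAnalytic 1 lowerHalf fun z => (cayley z)⁻¹ := by
  simpa only [cayley_neg] using bddAnalytic_cayley.reflect_upper

theorem BddAnalytic.inv_cayley_pow_mul (hb : BddAnalytic K lowerHalf b) (p : ℕ) :
    ∃ K', BddAnalytic K' lowerHalf fun z => (cayley z)⁻¹ ^ p * b z :=
  ⟨_, (bddAnalytic_inv_cayley.pow p).mul hb⟩

/-- After r powers of w are used up by the moment, the remaining p - r ≥ 1 powers vanish at i. -/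
theorem integral_moment_upper_eq_zero (hb : BddAnalytic K upperHalf b)
    (ha : BddAnalytic L lowerHalf a)
    (hm : ∀ x : ℝ, m x = cayley x ^ p * b x + (cayley x)⁻¹ ^ q * a x) {r : ℕ} (hr : 1 ≤ r)
    (hrp : r + 1 ≤ p) : ∫ x : ℝ, m x / ((x : ℂ) - I) ^ (r + 1) = 0 := by
  obtain ⟨K', hb'⟩ := hb.cayley_pow_mul (p - r)
  obtain ⟨L', ha'⟩ := ha.inv_cayley_pow_mul q
  rw [integral_moment_upper hb' ha' hr fun x => ?_]
  · simp only [cayley_I]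
    rw [zero_pow (by omega)]
    simp
  · rw [hm, ← mul_assoc, ← pow_add, Nat.add_sub_of_le (by omega)]

theorem integral_moment_lower_eq_zero (hb : BddAnalytic K upperHalf b)
    (ha : BddAnalytic L lowerHalf a)
    (hm : ∀ x : ℝ, m x = cayley x ^ p * b x + (cayley x)⁻¹ ^ q * a x) {r : ℕ} (hr : 1 ≤ r)
    (hrq : r + 1 ≤ q) : ∫ x : ℝ, m x / ((x : ℂ) + I) ^ (r + 1) = 0 := by
  obtain ⟨K', hb'⟩ := hb.cayley_pow_mul p
  obtain ⟨L', ha'⟩ := ha.inv_cayley_pow_mul (q - r)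
  rw [integral_moment_lower hb' ha' hr fun x => ?_]
  · simp only [inv_cayley_neg_I]
    rw [zero_pow (by omega)]
    simp
  · rw [hm, ← mul_assoc _ _ (a x), ← pow_add, Nat.add_sub_of_le (by omega)]

/-- Solution of the scalar jump problem with prescribed zeros at `i` and `-i`. -/
theorem exists_scalar_solution (hμ0 : 0 < μ) (hμ1 : μ < 1) (p q : ℕ) (B : ℝ) :
    ∃ E, ∀ (m : ℝ → ℂ) (c : ℂ), HolderBound μ B m →
      (p = 0 → q = 0 → ‖c‖ ≤ B) → (1 ≤ p → c = 0) →
      (1 ≤ q → c = -(1 / Real.pi) * ∫ x : ℝ, m x / ((x : ℂ) ^ 2 + 1)) →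
      (∀ r : ℕ, 1 ≤ r → r + 1 ≤ p → ∫ x : ℝ, m x / ((x : ℂ) - I) ^ (r + 1) = 0) →
      (∀ r : ℕ, 1 ≤ r → r + 1 ≤ q → ∫ x : ℝ, m x / ((x : ℂ) + I) ^ (r + 1) = 0) →
      ∃ a b : ℂ → ℂ, HolderAnalytic μ E lowerHalf a ∧ HolderAnalytic μ E upperHalf b ∧
        (∀ x : ℝ, m x = cayley x ^ p * b x + (cayley x)⁻¹ ^ q * a x) ∧
        (∀ z ∈ lowerHalf, omegaMinus m z + c = (cayley z)⁻¹ ^ q * a z) ∧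
        (∀ z ∈ upperHalf, omegaPlus m z - c = cayley z ^ p * b z) := by
  obtain ⟨D, hD0, hD⟩ := exists_jump hμ0 hμ1
  obtain ⟨D₁, hD₁0, hD₁⟩ := exists_factor_upper
  obtain ⟨D₂, hD₂0, hD₂⟩ := exists_factor_lower
  obtain ⟨E₁, hE₁⟩ : ∃ E, HolderBound μ E fun x => (cayley x)⁻¹ ^ p := by
    obtain ⟨E, hE⟩ := UnifHolder.pow (S := {0})
      (UnifHolder.of_const (holderAnalytic_inv_cayley hμ0 hμ1)) p
    exact ⟨E, (hE 0 rfl).holder⟩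
  obtain ⟨E₂, hE₂⟩ : ∃ E, HolderBound μ E fun x => cayley x ^ q := by
    obtain ⟨E, hE⟩ := UnifHolder.pow (S := {0})
      (UnifHolder.of_const (holderAnalytic_cayley hμ0 hμ1)) q
    exact ⟨E, (hE 0 rfl).holder⟩
  -- D * B bounds P and Q; the bracket bounds the shift P(i) + c, using |c| ≤ B + 2DB, which covers
  -- the free, zero and prescribed values of c.
  set K' := D * B + (D * B + (B + 2 * (D * B))) with hK'
  refine ⟨D₁ ^ p * K' + D₂ ^ q * K' + 2 * E₁ * K' + 2 * E₂ * K',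
    fun m c hm hfree hp hq hmp hmq => ?_⟩
  obtain ⟨P, Q, hP, hQ, hPQ⟩ := hD B m hm
  have hPI : ‖P I‖ ≤ D * B := hP.bound I (subset_closure I_mem_upperHalf)
  have hQI : ‖Q (-I)‖ ≤ D * B := hQ.bound (-I) (subset_closure neg_I_mem_lowerHalf)
  have hDB := (norm_nonneg _).trans hPI
  have hB := hm.nonneg
  have hint := integral_div_sq_add_one hP.toBddAnalytic hQ.toBddAnalytic hPQ
  have hpi : (Real.pi : ℂ) ≠ 0 := ofReal_ne_zero.2 Real.pi_ne_zero
  have hq' : 1 ≤ q → c = -(P I + Q (-I)) := fun h => by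
    rw [hq h, hint]
    field_simp
  have hc : ‖c‖ ≤ B + 2 * (D * B) := by
    rcases Nat.eq_zero_or_pos p with h1 | h1
    · rcases Nat.eq_zero_or_pos q with h2 | h2
      · linarith [hfree h1 h2]
      · rw [hq' h2, norm_neg]
        linarith [norm_add_le (P I) (Q (-I))]
    · rw [hp h1, norm_zero]
      positivity
  have hcP : ‖P I + c‖ ≤ D * B + (B + 2 * (D * B)) := (norm_add_le _ _).trans (by linarith)
  -- By the formulas for Ω⁺ and Ω⁻, these shifted functions are Ω⁺m - c and Ω⁻m + c. The first
  -- vanishes at i iff c = 0, the second at -i iff c = -(P(i) + Q(-i)).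
  have hP' : HolderAnalytic μ K' upperHalf fun z => P z - (P I + c) := hP.sub_const hcP le_rfl
  have hQ' : HolderAnalytic μ K' lowerHalf fun z => Q z + (P I + c) := by
    simpa only [sub_neg_eq_add] using
      hQ.sub_const (c := -(P I + c)) (L := K') (by rwa [norm_neg]) le_rfl
  have hsum : ∀ x : ℝ, m x = (P x - (P I + c)) + (Q x + (P I + c)) := fun x => by
    rw [hPQ]; ring
  obtain ⟨b, hb, hPb⟩ := hD₁ p K' K' _ _ m hP'.toBddAnalytic hQ'.toBddAnalytic hsum
    (fun h => by simp [hp h]) hmp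
  obtain ⟨a, ha, hQa⟩ := hD₂ q K' K' _ _ m hP'.toBddAnalytic hQ'.toBddAnalytic hsum
    (fun h => by simp only [hq' h]; ring) hmq
  have hK'0 : 0 ≤ K' := hP'.holder.nonneg
  have hE₁0 := hE₁.nonneg
  have hE₂0 := hE₂.nonneg
  -- Dividing out zeros controls only the supremum. The Hölder norm of a and b is recovered on the
  -- line, where the power of w is invertible with Hölder inverse.
  have hbx : ∀ x : ℝ, b x = (cayley x)⁻¹ ^ p * (P x - (P I + c)) := fun x => by
    rw [hPb x (ofReal_mem_closure_upperHalf x), ← mul_assoc, ← mul_pow,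
      inv_mul_cancel₀ (cayley_ofReal_ne_zero x), one_pow, one_mul]
  have hax : ∀ x : ℝ, a x = cayley x ^ q * (Q x + (P I + c)) := fun x => by
    rw [hQa x (ofReal_mem_closure_lowerHalf x), ← mul_assoc, ← mul_pow,
      mul_inv_cancel₀ (cayley_ofReal_ne_zero x), one_pow, one_mul]
  have n1 : 0 ≤ D₁ ^ p * K' := by positivity
  have n2 : 0 ≤ D₂ ^ q * K' := by positivity
  have n3 : 0 ≤ 2 * E₁ * K' := by positivity
  have n4 : 0 ≤ 2 * E₂ * K' := by positivity
  refine ⟨a, b, ⟨ha.mono (by linarith), ?_⟩, ⟨hb.mono (by linarith), ?_⟩, fun x => ?_,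
    fun z hz => ?_, fun z hz => ?_⟩
  · simp_rw [hax]
    exact (hE₂.mul hQ'.holder).mono (by linarith)
  · simp_rw [hbx]
    exact (hE₁.mul hP'.holder).mono (by linarith)
  · rw [← hPb x (ofReal_mem_closure_upperHalf x), ← hQa x (ofReal_mem_closure_lowerHalf x)]
    exact hsum x
  · rw [omegaMinus_eq hP.toBddAnalytic hQ.toBddAnalytic hPQ hz, ← hQa z (subset_closure hz)]
    ring
  · rw [omegaPlus_eq hP.toBddAnalytic hQ.toBddAnalytic hPQ hz, ← hPb z (subset_closure hz)]
    ring

end Scalar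

/-! ### The diagonal factors Λ⁺ and Λ⁻ -/

section Lam

variable {n : ℕ} {κ : Fin n → ℤ}

/-- With natural exponents this and the next three formulas hold at every z, including ±i; only
multiplying powers together, in `lam_add`, requires w ≠ 0. -/
theorem lam_posIdx (κ : Fin n → ℤ) (z : ℂ) :
    lam (posIdx κ) z = Matrix.diagonal fun j => cayley z ^ (κ j).toNat := by
  rw [lam]
  congr 1 with j
  rw [posIdx, ← Int.ofNat_toNat, zpow_natCast]
  rfl

theorem lam_neg_negIdx (κ : Fin n → ℤ) (z : ℂ) :
    lam (-negIdx κ) z = Matrix.diagonal fun j => cayley z ^ (-κ j).toNat := by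
  rw [lam]
  congr 1 with j
  have : (-negIdx κ) j = ((-κ j).toNat : ℤ) := by
    rw [Pi.neg_apply, negIdx]
    omega
  rw [this, zpow_natCast]
  rfl

theorem lam_neg_posIdx (κ : Fin n → ℤ) (z : ℂ) :
    lam (-posIdx κ) z = Matrix.diagonal fun j => (cayley z)⁻¹ ^ (κ j).toNat := by
  rw [lam]
  congr 1 with j
  have : (-posIdx κ) j = -((κ j).toNat : ℤ) := by
    rw [Pi.neg_apply, posIdx]
    omega
  rw [this, zpow_neg, zpow_natCast, inv_pow]
  rfl

theorem lam_negIdx (κ : Fin n → ℤ) (z : ℂ) :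
    lam (negIdx κ) z = Matrix.diagonal fun j => (cayley z)⁻¹ ^ (-κ j).toNat := by
  rw [lam]
  congr 1 with j
  have : negIdx κ j = -((-κ j).toNat : ℤ) := by
    rw [negIdx]
    omega
  rw [this, zpow_neg, zpow_natCast, inv_pow]
  rfl

theorem lam_add {z : ℂ} (hz : cayley z ≠ 0) (κ ν : Fin n → ℤ) :
    lam κ z * lam ν z = lam (κ + ν) z := by
  rw [lam, lam, lam, Matrix.diagonal_mul_diagonal]
  congr 1 with j
  exact (zpow_add₀ hz _ _).symm

theorem lam_zero (z : ℂ) : lam (0 : Fin n → ℤ) z = 1 := by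
  simp [lam]

theorem posIdx_add_negIdx (κ : Fin n → ℤ) : posIdx κ + negIdx κ = κ := by
  ext j
  simp only [Pi.add_apply, posIdx, negIdx]
  omega

theorem cayley_ne_zero {z : ℂ} (h1 : z ≠ I) (h2 : z ≠ -I) : cayley z ≠ 0 := by
  rw [cayley]
  exact div_ne_zero (sub_ne_zero.2 h1) fun h => h2 (eq_neg_of_add_eq_zero_left h)

theorem ne_I_of_mem_lowerHalf {z : ℂ} (hz : z ∈ lowerHalf) : z ≠ I := fun h =>
  sub_I_ne_zero (subset_closure hz) (sub_eq_zero.2 h)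

theorem ne_neg_I_of_mem_upperHalf {z : ℂ} (hz : z ∈ upperHalf) : z ≠ -I := fun h =>
  add_I_ne_zero (subset_closure hz) (by rw [h]; ring)

theorem unifMat_lam_neg_posIdx {μ : ℝ} (hμ0 : 0 < μ) (hμ1 : μ < 1) {S : Set ℝ} (κ : Fin n → ℤ) :
    UnifMat μ lowerHalf S fun _ => lam (-posIdx κ) := by
  simp only [funext (lam_neg_posIdx κ)]
  exact UnifMat.diagonal fun j =>
    (UnifHolder.of_const (holderAnalytic_inv_cayley hμ0 hμ1)).pow _

theorem unifMat_lam_neg_negIdx {μ : ℝ} (hμ0 : 0 < μ) (hμ1 : μ < 1) {S : Set ℝ} (κ : Fin n → ℤ) :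
    UnifMat μ upperHalf S fun _ => lam (-negIdx κ) := by
  simp only [funext (lam_neg_negIdx κ)]
  exact UnifMat.diagonal fun j => (UnifHolder.of_const (holderAnalytic_cayley hμ0 hμ1)).pow _

end Lam

/-! ### Formal solutions and necessity of the conditions -/

section Formal

variable {n : ℕ} {κ : Fin n → ℤ} {Gm Gp Nm Np A B : ℂ → Matrix (Fin n) (Fin n) ℂ}
  {M : ℝ → Matrix (Fin n) (Fin n) ℂ} {C : Matrix (Fin n) (Fin n) ℂ}

theorem isFormalSolution_of_factor (hNm : ∀ z ∈ lowerHalf, Nm z = Gm z * A z)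
    (hNp : ∀ z ∈ upperHalf, Np z = B z * Gp z)
    (hA : ∀ z ∈ lowerHalf, ∀ l j, omegaMinus (fun τ => M τ l j) z + C l j =
      (cayley z)⁻¹ ^ (-κ j).toNat * A z l j)
    (hB : ∀ z ∈ upperHalf, ∀ l j, omegaPlus (fun τ => M τ l j) z - C l j =
      cayley z ^ (κ l).toNat * B z l j) :
    IsFormalSolution κ Gm Gp M C Nm Np := by
  refine ⟨fun z hz hz' => ?_, fun z hz hz' => ?_⟩
  · have e : Matrix.of (fun l j => omegaMinus (fun τ => M τ l j) z) + C = A z * lam (negIdx κ) z := by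
      ext l j
      rw [Matrix.add_apply, Matrix.of_apply, hA z hz, lam_negIdx, Matrix.mul_diagonal, mul_comm]
    rw [e, hNm z hz, Matrix.mul_assoc, Matrix.mul_assoc,
      lam_add (cayley_ne_zero (ne_I_of_mem_lowerHalf hz) hz'), add_neg_cancel, lam_zero,
      Matrix.mul_one]
  · have e : Matrix.of (fun l j => omegaPlus (fun τ => M τ l j) z) - C = lam (posIdx κ) z * B z := by
      ext l j
      rw [Matrix.sub_apply, Matrix.of_apply, hB z hz, lam_posIdx, Matrix.diagonal_mul]
    rw [e, hNp z hz, ← Matrix.mul_assoc,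
      lam_add (cayley_ne_zero hz' (ne_neg_I_of_mem_upperHalf hz)), neg_add_cancel, lam_zero,
      Matrix.one_mul]

theorem IsFormalSolution.const_unique {C' : Matrix (Fin n) (Fin n) ℂ}
    (hGm : ∀ z ∈ lowerHalf, IsUnit (Gm z)) (h : IsFormalSolution κ Gm Gp M C Nm Np)
    (h' : IsFormalSolution κ Gm Gp M C' Nm Np) : C = C' := by
  -- One point of the lower half-plane other than -i suffices, since there all the factors around C
  -- are invertible.
  have hz : (-(2 * I) : ℂ) ∈ lowerHalf := by simp [lowerHalf]
  have hz' : (-(2 * I) : ℂ) ≠ -I := fun h => by simpa using congrArg im h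
  have e := (h.1 _ hz hz').symm.trans (h'.1 _ hz hz')
  have hlam := lam_add (cayley_ne_zero (ne_I_of_mem_lowerHalf hz) hz') (-negIdx κ) (negIdx κ)
  rw [neg_add_cancel, lam_zero] at hlam
  have e2 := congrArg (fun X => X * lam (negIdx κ) (-(2 * I))) e
  simp only [Matrix.mul_assoc, hlam, Matrix.mul_one] at e2
  exact add_left_cancel ((hGm _ hz).mul_left_cancel e2)

/-- The decoupling: entry (l, j) involves only the index of its row through Λ⁺ and that of its
column through Λ⁻. -/
theorem mul_lam_add_lam_mul_apply (κ : Fin n → ℤ) (X Y : Matrix (Fin n) (Fin n) ℂ) (z : ℂ)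
    (l j : Fin n) : (X * lam (negIdx κ) z + lam (posIdx κ) z * Y) l j =
      cayley z ^ (κ l).toNat * Y l j + (cayley z)⁻¹ ^ (-κ j).toNat * X l j := by
  rw [Matrix.add_apply, lam_negIdx, lam_posIdx, Matrix.mul_diagonal, Matrix.diagonal_mul, add_comm,
    mul_comm (X l j)]

/-- The solvability conditions are necessary, and the constants and the solution are determined. -/
theorem solvability_of_factor {K : ℝ} (hA : ∀ i j, BddAnalytic K lowerHalf fun z => A z i j)
    (hB : ∀ i j, BddAnalytic K upperHalf fun z => B z i j)
    (hM : ∀ x : ℝ, M x = A x * lam (negIdx κ) x + lam (posIdx κ) x * B x) :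
    SolvabilityConditions κ M ∧ ∃ C : Matrix (Fin n) (Fin n) ℂ, PrescribedConstants κ M C ∧
      (∀ z ∈ lowerHalf, ∀ l j, omegaMinus (fun τ => M τ l j) z + C l j =
        (cayley z)⁻¹ ^ (-κ j).toNat * A z l j) ∧
      (∀ z ∈ upperHalf, ∀ l j, omegaPlus (fun τ => M τ l j) z - C l j =
        cayley z ^ (κ l).toNat * B z l j) := by
  have hm : ∀ l j, ∀ x : ℝ, M x l j = cayley x ^ (κ l).toNat * B x l j +
      (cayley x)⁻¹ ^ (-κ j).toNat * A x l j := fun l j x => by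
    rw [hM, mul_lam_add_lam_mul_apply]
  have hP := fun l j => (hB l j).cayley_pow_mul (κ l).toNat
  have hQ := fun l j => (hA l j).inv_cayley_pow_mul (-κ j).toNat
  choose KP hP using hP
  choose KQ hQ using hQ
  have hint := fun l j => integral_div_sq_add_one (hP l j) (hQ l j) (hm l j)
  have hPI : ∀ l j, 0 < κ l → cayley I ^ (κ l).toNat * B I l j = 0 := fun l j h => by
    rw [cayley_I, zero_pow (by omega), zero_mul]
  have hQI : ∀ l j, κ j < 0 → (cayley (-I))⁻¹ ^ (-κ j).toNat * A (-I) l j = 0 := fun l j h => by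
    rw [inv_cayley_neg_I, zero_pow (by omega), zero_mul]
  refine ⟨⟨fun k hk r hr hrk l => ?_, fun k hk r hr hrk j => ?_, fun l j hl hj => ?_⟩,
    -- The witness is -P(i), the only constant compatible with Ω⁺m = P - P(i).
    Matrix.of fun l j => -(cayley I ^ (κ l).toNat * B I l j), ⟨fun k hk l => ?_, fun k hk j => ?_⟩,
    fun z hz l j => ?_, fun z hz l j => ?_⟩
  · exact integral_moment_lower_eq_zero (hB l k) (hA l k) (hm l k) hr (by omega)
  · exact integral_moment_upper_eq_zero (hB k j) (hA k j) (hm k j) hr (by omega)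
  · rw [hint, hPI l j hl, hQI l j hj]
    simp
  · have hpi : (Real.pi : ℂ) ≠ 0 := ofReal_ne_zero.2 Real.pi_ne_zero
    rw [hint, hQI l k hk, Matrix.of_apply]
    field_simp
    ring
  · rw [Matrix.of_apply, hPI k j hk, neg_zero]
  · rw [omegaMinus_eq (hP l j) (hQ l j) (hm l j) hz, Matrix.of_apply]
    ring
  · rw [omegaPlus_eq (hP l j) (hQ l j) (hm l j) hz, Matrix.of_apply]
    ring

end Formal

/-! ### From the linearised equation to the asymptotic factorization -/

section Asymptotic

variable {n : ℕ} {μ : ℝ} {κ : Fin n → ℤ} {Gm Gp : ℂ → Matrix (Fin n) (Fin n) ℂ}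
  {G N : ℝ → ℝ → Matrix (Fin n) (Fin n) ℂ} {Nm Np A B : ℝ → ℂ → Matrix (Fin n) (Fin n) ℂ} {ε₁ : ℝ}

theorem IsFirstOrderFactorization.mono {ε₂ : ℝ} (h : ε₂ ≤ ε₁)
    (hf : IsFirstOrderFactorization μ κ Gm Gp G N Nm Np ε₁) :
    IsFirstOrderFactorization μ κ Gm Gp G N Nm Np ε₂ := by
  have hs : Ico 0 ε₂ ⊆ Ico 0 ε₁ := Ico_subset_Ico_right h
  exact ⟨fun ε hε => hf.analytic_minus ε (hs hε), fun ε hε => hf.analytic_plus ε (hs hε),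
    hf.bounded_minus.imp fun _ hK ε hε => hK ε (hs hε),
    hf.bounded_plus.imp fun _ hK ε hε => hK ε (hs hε),
    fun ε hε => hf.first_order ε (hs hε),
    hf.factorization.imp fun _ hK ε hε => hK ε (hs hε),
    hf.remainder.imp fun _ hK ε hε => hK ε (hs hε)⟩

/-- Multiplying the first-order equation by (G₀⁻)⁻¹ on the left and (G₀⁺)⁻¹ on the right gives M =
AΛ⁻ + Λ⁺B with bounded analytic A and B. -/
theorem IsFirstOrderFactorization.solvability {K : ℝ} (hGm : IsBoundedFactor μ K lowerHalf Gm)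
    (hGp : IsBoundedFactor μ K upperHalf Gp)
    (hf : IsFirstOrderFactorization μ κ Gm Gp G N Nm Np ε₁) {ε : ℝ} (hε : ε ∈ Ico 0 ε₁) :
    SolvabilityConditions κ (midMatrix Gm Gp (N ε)) ∧ ∃ C : Matrix (Fin n) (Fin n) ℂ,
      PrescribedConstants κ (midMatrix Gm Gp (N ε)) C ∧
      IsFormalSolution κ Gm Gp (midMatrix Gm Gp (N ε)) C (Nm ε) (Np ε) := by
  have hNm : UnifMat μ lowerHalf (Ico 0 ε₁) Nm := fun i j => by
    obtain ⟨L, hL⟩ := hf.bounded_minus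
    exact ⟨L, fun ε hε => ⟨⟨hf.analytic_minus ε hε i j, fun z hz => (hL ε hε).1 z hz i j⟩,
      (hL ε hε).2 i j⟩⟩
  have hNp : UnifMat μ upperHalf (Ico 0 ε₁) Np := fun i j => by
    obtain ⟨L, hL⟩ := hf.bounded_plus
    exact ⟨L, fun ε hε => ⟨⟨hf.analytic_plus ε hε i j, fun z hz => (hL ε hε).1 z hz i j⟩,
      (hL ε hε).2 i j⟩⟩
  obtain ⟨KA, -, hA⟩ := (hGm.unifMat_inv.mul hNm).exists_bound
  obtain ⟨KB, -, hB⟩ := (hNp.mul hGp.unifMat_inv).exists_bound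
  have hm := ofReal_mem_closure_lowerHalf
  have hp := ofReal_mem_closure_upperHalf
  obtain ⟨hs, C, hC, h1, h2⟩ := solvability_of_factor (κ := κ) (M := midMatrix Gm Gp (N ε))
    (A := fun z => (Gm z)⁻¹ * Nm ε z) (B := fun z => Np ε z * (Gp z)⁻¹)
    (fun i j => (hA ε hε i j).toBddAnalytic.mono (le_max_left KA KB))
    (fun i j => (hB ε hε i j).toBddAnalytic.mono (le_max_right KA KB)) fun x => by
      have u1 := Matrix.nonsing_inv_mul _ ((Matrix.isUnit_iff_isUnit_det _).1 (hGm.isUnit _ (hm x)))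
      have u2 := Matrix.mul_nonsing_inv _ ((Matrix.isUnit_iff_isUnit_det _).1 (hGp.isUnit _ (hp x)))
      rw [midMatrix, ← hf.first_order ε hε x, Matrix.mul_add, Matrix.add_mul]
      congr 1
      · simp only [Matrix.mul_assoc, u2, Matrix.mul_one]
      · simp only [← Matrix.mul_assoc, u1, Matrix.one_mul]
  refine ⟨hs, C, hC, isFormalSolution_of_factor (fun z hz => ?_) (fun z hz => ?_) h1 h2⟩
  · rw [Matrix.mul_nonsing_inv_cancel_left _ _
      ((Matrix.isUnit_iff_isUnit_det _).1 (hGm.isUnit _ (subset_closure hz)))]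
  · rw [Matrix.nonsing_inv_mul_cancel_right _ _
      ((Matrix.isUnit_iff_isUnit_det _).1 (hGp.isUnit _ (subset_closure hz)))]

/-- The orders 0 and 1 cancel, and (Λ⁺)⁻¹Λ(Λ⁻)⁻¹ = 1 reduces the quadratic term to N⁻N⁺: the error
is exact, with no higher terms. -/
theorem sub_approx_eq {x : ℝ} {ε : ℝ} (h0 : G 0 x = Gm x * lam κ x * Gp x)
    (hG : G ε x = G 0 x + (ε : ℂ) • N ε x)
    (h1 : Nm ε x * lam (negIdx κ) x * Gp x + Gm x * lam (posIdx κ) x * Np ε x = N ε x) :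
    G ε x - approx κ Gm Gp ε (Nm ε) (Np ε) x = (-(ε : ℂ) ^ 2) • (Nm ε x * Np ε x) := by
  have hz := cayley_ofReal_ne_zero x
  have l1 : lam (-posIdx κ) (x : ℂ) * lam κ x = lam (negIdx κ) x := by
    rw [lam_add hz]
    congr 1
    nth_rw 2 [← posIdx_add_negIdx κ]
    abel
  have l2 : lam κ (x : ℂ) * lam (-negIdx κ) x = lam (posIdx κ) x := by
    rw [lam_add hz]
    congr 1
    nth_rw 1 [← posIdx_add_negIdx κ]
    abel
  have l3 : lam (negIdx κ) (x : ℂ) * lam (-negIdx κ) x = 1 := by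
    rw [lam_add hz, add_neg_cancel, lam_zero]
  have e1 : minusFactor κ Gm ε (Nm ε) x * lam κ x =
      Gm x * lam κ x + (ε : ℂ) • (Nm ε x * lam (negIdx κ) x) := by
    rw [minusFactor, Matrix.add_mul, Matrix.smul_mul, Matrix.mul_assoc (Nm ε x), l1]
  have e2 : Gm x * lam κ x * (lam (-negIdx κ) x * Np ε x) = Gm x * lam (posIdx κ) x * Np ε x := by
    rw [← Matrix.mul_assoc, Matrix.mul_assoc (Gm x), l2]
  have e3 : Nm ε x * lam (negIdx κ) x * (lam (-negIdx κ) x * Np ε x) = Nm ε x * Np ε x := by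
    rw [← Matrix.mul_assoc, Matrix.mul_assoc (Nm ε x), l3, Matrix.mul_one]
  rw [approx, e1, plusFactor, Matrix.add_mul, Matrix.mul_add, Matrix.mul_add, Matrix.mul_smul,
    Matrix.smul_mul, Matrix.smul_mul, Matrix.mul_smul, e2, e3, hG, h0, ← h1]
  module

/-- A bounded solution of the linearised problem gives a first order factorization. -/
theorem exists_isFirstOrderFactorization {K : ℝ} (hμ0 : 0 < μ) (hμ1 : μ < 1)
    (hfac : IsBoundedFactorization μ K κ Gm Gp (G 0)) (hε₁ : 0 < ε₁)
    (hG : ∀ ε ∈ Ico 0 ε₁, ∀ x : ℝ, G ε x = G 0 x + (ε : ℂ) • N ε x)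
    (hA : UnifMat μ lowerHalf (Ico 0 ε₁) A) (hB : UnifMat μ upperHalf (Ico 0 ε₁) B)
    (hM : ∀ ε ∈ Ico 0 ε₁, ∀ x : ℝ, midMatrix Gm Gp (N ε) x =
      A ε x * lam (negIdx κ) x + lam (posIdx κ) x * B ε x) :
    ∃ ε₂ > 0, ε₂ ≤ ε₁ ∧ IsFirstOrderFactorization μ κ Gm Gp G N (fun ε z => Gm z * A ε z)
      (fun ε z => B ε z * Gp z) ε₂ := by
  have hmU := ofReal_mem_closure_lowerHalf
  have hpU := ofReal_mem_closure_upperHalf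
  obtain ⟨δ₁, hδ₁, h₁⟩ := (hA.mul (unifMat_lam_neg_posIdx hμ0 hμ1 κ)).one_add_smul hmU
  obtain ⟨δ₂, hδ₂, h₂⟩ := (UnifMat.mul (unifMat_lam_neg_negIdx hμ0 hμ1 κ) hB).one_add_smul hpU
  set ε₂ := min ε₁ (min δ₁ δ₂) with hε₂
  have le1 : ε₂ ≤ ε₁ := min_le_left _ _
  obtain ⟨m1, m2, m3⟩ := h₁ ε₂ ((min_le_right _ _).trans (min_le_left _ _)) le1
  obtain ⟨p1, p2, p3⟩ := h₂ ε₂ ((min_le_right _ _).trans (min_le_right _ _)) le1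
  have hs : Ico 0 ε₂ ⊆ Ico 0 ε₁ := Ico_subset_Ico_right le1
  have hNm : UnifMat μ lowerHalf (Ico 0 ε₂) fun ε z => Gm z * A ε z :=
    hfac.minus.unifMat.mul (hA.mono hs)
  have hNp : UnifMat μ upperHalf (Ico 0 ε₂) fun ε z => B ε z * Gp z :=
    UnifMat.mul (hB.mono hs) hfac.plus.unifMat
  -- Pulling G₀⁻ out to the left (and below G₀⁺ to the right) leaves a perturbation of the identity,
  -- bounded and analytic because (Λ⁺)⁻¹ is analytic in the lower half-plane and (Λ⁻)⁻¹ in the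
  -- upper.
  have hmin : ∀ (ε : ℝ) (z : ℂ), minusFactor κ Gm ε (fun z => Gm z * A ε z) z =
      Gm z * (1 + (ε : ℂ) • (A ε z * lam (-posIdx κ) z)) := fun ε z => by
    rw [minusFactor, Matrix.mul_add, Matrix.mul_one, Matrix.mul_smul, Matrix.mul_assoc]
  have hplus : ∀ (ε : ℝ) (z : ℂ), plusFactor κ Gp ε (fun z => B ε z * Gp z) z =
      (1 + (ε : ℂ) • (lam (-negIdx κ) z * B ε z)) * Gp z := fun ε z => by
    rw [plusFactor, Matrix.add_mul, Matrix.one_mul, Matrix.smul_mul, Matrix.mul_assoc]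
  obtain ⟨Km, hKm⟩ := exists_isBoundedFactor (S := Ico 0 ε₂)
    (F := fun ε z => minusFactor κ Gm ε (fun z => Gm z * A ε z) z)
    (by simp only [hmin]; exact hfac.minus.unifMat.mul m1)
    (by simp only [hmin, Matrix.mul_inv_rev]; exact m2.mul hfac.minus.unifMat_inv)
    fun ε hε z hz => by simp only [hmin]; exact (hfac.minus.isUnit z hz).mul (m3 ε hε z hz)
  obtain ⟨Kp, hKp⟩ := exists_isBoundedFactor (S := Ico 0 ε₂)
    (F := fun ε z => plusFactor κ Gp ε (fun z => B ε z * Gp z) z)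
    (by simp only [hplus]; exact p1.mul hfac.plus.unifMat)
    (by simp only [hplus, Matrix.mul_inv_rev]; exact hfac.plus.unifMat_inv.mul p2)
    fun ε hε z hz => by simp only [hplus]; exact (p3 ε hε z hz).mul (hfac.plus.isUnit z hz)
  obtain ⟨L, -, hL⟩ := hNm.exists_bound
  obtain ⟨L', -, hL'⟩ := hNp.exists_bound
  have hfirst : ∀ ε ∈ Ico 0 ε₂, ∀ x : ℝ, Gm x * A ε x * lam (negIdx κ) x * Gp x +
      Gm x * lam (posIdx κ) x * (B ε x * Gp x) = N ε x := fun ε hε x => by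
    have d1 := (Matrix.isUnit_iff_isUnit_det _).1 (hfac.minus.isUnit _ (hmU x))
    have d2 := (Matrix.isUnit_iff_isUnit_det _).1 (hfac.plus.isUnit _ (hpU x))
    have e : Gm x * A ε x * lam (negIdx κ) x * Gp x + Gm x * lam (posIdx κ) x * (B ε x * Gp x) =
        Gm x * (midMatrix Gm Gp (N ε) x) * Gp x := by
      rw [hM ε (hs hε), Matrix.mul_add, Matrix.add_mul]
      simp only [Matrix.mul_assoc]
    rw [e, midMatrix, ← Matrix.mul_assoc, Matrix.nonsing_inv_mul_cancel_right _ _ d2,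
      Matrix.mul_nonsing_inv_cancel_left _ _ d1]
  refine ⟨ε₂, lt_min hε₁ (lt_min hδ₁ hδ₂), le1, ⟨fun ε hε i j => (hL ε hε i j).diff,
    fun ε hε i j => (hL' ε hε i j).diff,
    ⟨L, fun ε hε => ⟨fun z hz i j => (hL ε hε i j).bound z hz, fun i j => (hL ε hε i j).holder⟩⟩,
    ⟨L', fun ε hε => ⟨fun z hz i j => (hL' ε hε i j).bound z hz, fun i j => (hL' ε hε i j).holder⟩⟩,
    hfirst,
    ⟨max Km Kp, fun ε hε => ⟨hKm _ (le_max_left _ _) ε hε, hKp _ (le_max_right _ _) ε hε,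
      fun _ => rfl⟩⟩, ⟨n * (2 * L * L'), fun ε hε i j => ?_⟩⟩⟩
  have hmul := MatHolderBound.mul (μ := μ) (F := fun x : ℝ => Gm x * A ε x)
    (H := fun x : ℝ => B ε x * Gp x) (fun i j => (hL ε hε i j).holder)
    (fun i j => (hL' ε hε i j).holder) i j
  have := hmul.const_mul (-(ε : ℂ) ^ 2)
  rw [norm_neg, norm_pow, norm_real, Real.norm_of_nonneg hε.1, mul_comm] at this
  have e : ∀ x : ℝ, G ε x - approx κ Gm Gp ε (fun z => Gm z * A ε z) (fun z => B ε z * Gp z) x =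
      (-(ε : ℂ) ^ 2) • (Gm x * A ε x * (B ε x * Gp x)) := fun x =>
    sub_approx_eq (Nm := fun ε z => Gm z * A ε z) (Np := fun ε z => B ε z * Gp z)
      (hfac.eq x) (hG ε (hs hε) x) (hfirst ε hε x)
  simp only [e, Matrix.smul_apply, smul_eq_mul]
  exact this

/-- The solvability conditions are sufficient. -/
theorem exists_formalSolution_factors {K : ℝ} (hμ0 : 0 < μ) (hμ1 : μ < 1) {S : Set ℝ}
    {M : ℝ → ℝ → Matrix (Fin n) (Fin n) ℂ} {C : ℝ → Matrix (Fin n) (Fin n) ℂ}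
    (hM : ∀ ε ∈ S, MatHolderBound μ K (M ε))
    (hC : ∀ l j, κ l ≤ 0 → 0 ≤ κ j → ∃ K, ∀ ε ∈ S, ‖C ε l j‖ ≤ K)
    (hs : ∀ ε ∈ S, SolvabilityConditions κ (M ε) ∧ PrescribedConstants κ (M ε) (C ε)) :
    ∃ A B : ℝ → ℂ → Matrix (Fin n) (Fin n) ℂ,
      UnifMat μ lowerHalf S A ∧ UnifMat μ upperHalf S B ∧
      (∀ ε ∈ S, ∀ x : ℝ, M ε x = A ε x * lam (negIdx κ) x + lam (posIdx κ) x * B ε x) ∧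
      ∀ ε ∈ S, (∀ z ∈ lowerHalf, ∀ l j, omegaMinus (fun τ => M ε τ l j) z + C ε l j =
        (cayley z)⁻¹ ^ (-κ j).toNat * A ε z l j) ∧
      (∀ z ∈ upperHalf, ∀ l j, omegaPlus (fun τ => M ε τ l j) z - C ε l j =
        cayley z ^ (κ l).toNat * B ε z l j) := by
  -- E is chosen before ε, which is the uniformity. The condition ε ∈ S stands after a and b so that
  -- choice yields functions of all ε.
  have key : ∀ l j, ∃ E, ∀ ε, ∃ a b : ℂ → ℂ, ε ∈ S →
      HolderAnalytic μ E lowerHalf a ∧ HolderAnalytic μ E upperHalf b ∧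
        (∀ x : ℝ, M ε x l j = cayley x ^ (κ l).toNat * b x + (cayley x)⁻¹ ^ (-κ j).toNat * a x) ∧
        (∀ z ∈ lowerHalf, omegaMinus (fun τ => M ε τ l j) z + C ε l j =
          (cayley z)⁻¹ ^ (-κ j).toNat * a z) ∧
        (∀ z ∈ upperHalf, omegaPlus (fun τ => M ε τ l j) z - C ε l j =
          cayley z ^ (κ l).toNat * b z) := by
    intro l j
    -- Only free entries come with a bound; for the others 0 is a dummy, as their size follows from
    -- the prescribed values.
    obtain ⟨K', hK'⟩ : ∃ K', κ l ≤ 0 → 0 ≤ κ j → ∀ ε ∈ S, ‖C ε l j‖ ≤ K' := by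
      by_cases h : κ l ≤ 0 ∧ 0 ≤ κ j
      · obtain ⟨K', hK'⟩ := hC l j h.1 h.2
        exact ⟨K', fun _ _ => hK'⟩
      · exact ⟨0, fun h1 h2 => absurd ⟨h1, h2⟩ h⟩
    obtain ⟨E, hE⟩ := exists_scalar_solution hμ0 hμ1 (κ l).toNat (-κ j).toNat (max K K')
    refine ⟨E, fun ε => ?_⟩
    by_cases hε : ε ∈ S
    · obtain ⟨hsol, hpre⟩ := hs ε hε
      obtain ⟨a, b, h⟩ := hE (fun τ => M ε τ l j) (C ε l j) ((hM ε hε l j).mono (le_max_left _ _))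
        (fun h1 h2 => (hK' (by omega) (by omega) ε hε).trans (le_max_right _ _))
        (fun h => hpre.pos l (by omega) j) (fun h => hpre.neg j (by omega) l)
        (fun r h1 h2 => hsol.pos l (by omega) r h1 (by omega) j)
        (fun r h1 h2 => hsol.neg j (by omega) r h1 (by omega) l)
      exact ⟨a, b, fun _ => h⟩
    · exact ⟨0, 0, fun h => absurd h hε⟩
  choose E a b h using key
  refine ⟨fun ε z => Matrix.of fun l j => a l j ε z, fun ε z => Matrix.of fun l j => b l j ε z,
    fun l j => ⟨E l j, fun ε hε => (h l j ε hε).1⟩, fun l j => ⟨E l j, fun ε hε => (h l j ε hε).2.1⟩,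
    fun ε hε x => ?_, fun ε hε => ⟨fun z hz l j => (h l j ε hε).2.2.2.1 z hz,
      fun z hz l j => (h l j ε hε).2.2.2.2 z hz⟩⟩
  ext l j
  rw [mul_lam_add_lam_mul_apply]
  exact (h l j ε hε).2.2.1 x

end Asymptotic

end WienerHopf

/-! ### The main theorem -/

theorem theorem1 {n : ℕ} (hn : 0 < n) (μ : ℝ) (hμ0 : 0 < μ) (hμ1 : μ < 1)
    (κ : Fin n → ℤ) (hκ : Antitone κ)
    (hunstable : 2 ≤ κ ⟨0, hn⟩ - κ ⟨n - 1, Nat.sub_lt hn Nat.one_pos⟩)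
    (Gm Gp : ℂ → Matrix (Fin n) (Fin n) ℂ) (G N : ℝ → ℝ → Matrix (Fin n) (Fin n) ℂ)
    (ε₀ : ℝ) (hε₀ : 0 < ε₀)
    (hfac : ∃ K, WienerHopf.IsBoundedFactorization μ K κ Gm Gp (G 0))
    (hN : ∃ K, ∀ ε ∈ Set.Ico 0 ε₀, WienerHopf.MatHolderBound μ K (N ε))
    (hG : ∀ ε ∈ Set.Ico 0 ε₀, ∀ x : ℝ, G ε x = G 0 x + (ε : ℂ) • N ε x) :
    -- the formula with the constants `C ε` gives a factorization iff the conditions hold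
    (∀ C : ℝ → Matrix (Fin n) (Fin n) ℂ,
      (∀ l j, κ l ≤ 0 → 0 ≤ κ j → ∃ K, ∀ ε ∈ Set.Ico 0 ε₀, ‖C ε l j‖ ≤ K) →
      ((∃ ε₁ > 0, ∃ Nm Np : ℝ → ℂ → Matrix (Fin n) (Fin n) ℂ,
          (∀ ε ∈ Set.Ico 0 ε₁, WienerHopf.IsFormalSolution κ Gm Gp
            (WienerHopf.midMatrix Gm Gp (N ε)) (C ε) (Nm ε) (Np ε)) ∧
          WienerHopf.IsFirstOrderFactorization μ κ Gm Gp G N Nm Np ε₁) ↔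
        (∃ ε₁ > 0, ∀ ε ∈ Set.Ico 0 ε₁,
          WienerHopf.SolvabilityConditions κ (WienerHopf.midMatrix Gm Gp (N ε)) ∧
          WienerHopf.PrescribedConstants κ (WienerHopf.midMatrix Gm Gp (N ε)) (C ε)))) ∧
    -- every factorization of this form arises in this way
    (∀ (Nm Np : ℝ → ℂ → Matrix (Fin n) (Fin n) ℂ) (ε₁ : ℝ), 0 < ε₁ → ε₁ ≤ ε₀ →
      WienerHopf.IsFirstOrderFactorization μ κ Gm Gp G N Nm Np ε₁ →
      ∀ ε ∈ Set.Ico 0 ε₁,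
        WienerHopf.SolvabilityConditions κ (WienerHopf.midMatrix Gm Gp (N ε)) ∧
        ∃ C : Matrix (Fin n) (Fin n) ℂ,
          WienerHopf.PrescribedConstants κ (WienerHopf.midMatrix Gm Gp (N ε)) C ∧
          WienerHopf.IsFormalSolution κ Gm Gp
            (WienerHopf.midMatrix Gm Gp (N ε)) C (Nm ε) (Np ε)) := by
  obtain ⟨K, hfac⟩ := hfac
  obtain ⟨KN, hN⟩ := hN
  refine ⟨fun C hC => ⟨?_, ?_⟩, fun Nm Np ε₁ _ _ hf ε hε => hf.solvability hfac.minus hfac.plus hε⟩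
  · rintro ⟨ε₁, hε₁, Nm, Np, hformal, hf⟩
    refine ⟨ε₁, hε₁, fun ε hε => ?_⟩
    obtain ⟨hs, C', hC', hformal'⟩ := hf.solvability hfac.minus hfac.plus hε
    -- The given N⁻ is also the formal solution for a constant satisfying (C); uniqueness of the
    -- constant transfers (C) to the given one.
    have e := (hformal ε hε).const_unique
      (fun z hz => hfac.minus.isUnit z (subset_closure hz)) hformal'
    exact ⟨hs, e ▸ hC'⟩
  · rintro ⟨ε₁, hε₁, hs⟩
    -- The interval on which the conditions hold may exceed the one on which the family is
    -- controlled.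
    have hsub₁ : Set.Ico 0 (min ε₁ ε₀) ⊆ Set.Ico 0 ε₁ := Set.Ico_subset_Ico_right (min_le_left _ _)
    have hsub₀ : Set.Ico 0 (min ε₁ ε₀) ⊆ Set.Ico 0 ε₀ := Set.Ico_subset_Ico_right (min_le_right _ _)
    obtain ⟨A, B, hA, hB, hM, hform⟩ := WienerHopf.exists_formalSolution_factors (κ := κ)
      (S := Set.Ico 0 (min ε₁ ε₀)) (C := C) hμ0 hμ1
      (fun ε hε => WienerHopf.MatHolderBound.mul
        (WienerHopf.MatHolderBound.mul hfac.minus.holder_inv (hN ε (hsub₀ hε))) hfac.plus.holder_inv)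
      (fun l j hl hj => (hC l j hl hj).imp fun _ h ε hε => h ε (hsub₀ hε))
      (fun ε hε => hs ε (hsub₁ hε))
    obtain ⟨ε₂, hε₂, hle, hf⟩ := WienerHopf.exists_isFirstOrderFactorization hμ0 hμ1 hfac
      (lt_min hε₁ hε₀) (fun ε hε => hG ε (hsub₀ hε)) hA hB hM
    refine ⟨ε₂, hε₂, _, _, fun ε hε => ?_, hf⟩
    have hε' := Set.Ico_subset_Ico_right hle hε
    exact WienerHopf.isFormalSolution_of_factor (fun _ _ => rfl) (fun _ _ => rfl)
      (hform ε hε').1 (hform ε hε').2
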